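/- Let $(X,d)$ be a Gromov hyperbolic metric space (four-point condition; neither geodesic nor proper is assumed) which is $\epsilon$-good for some $\epsilon>0$: for each base point $p\in X$ the Gromov product $(x,y)_p=\tfrac12(d(p,x)+d(p,y)-d(x,y))$ extends continuously, with values in $[0,\infty]$, to the bordification $X\cup\partial X$, and $d_\epsilon=\exp(-\epsilon(\cdot,\cdot)_p)$ is a metric on $\partial X$. Fix $p\in X$ and let $\beta_\xi(x,y)=\lim_{z\to\xi}(d(x,z)-d(y,z))$ be the Busemann functions, $\xi\in\partial X$. Let $\Gamma<\mathrm{Isom}(X)$ act metrically properly on $X$ (for all $x\in X$ and $R>0$ the set $\{\gamma\in\Gamma: d(x,\gamma x)<R\}$ is finite), with compact limit set $\Lambda=\Lambda_X\Gamma\subset\partial X$ and critical exponent $0<\delta<\infty$ of the Poincaré series $\sum_{\gamma\in\Gamma}e^{-s\,d(p,\gamma p)}$, and of divergence type (the series diverges at $s=\delta$). Let $\nu$ be a Patterson–Sullivan measure, that is, a Borel probability measure on $\Lambda$ with $$\frac{d(\gamma^{-1})_*\nu}{d\nu}(\xi)=e^{\delta\,\beta_\xi(p,\gamma^{-1}p)}\qquad(\gamma\in\Gamma).$$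 Let $\Lambda^{(2)}$ be the set of pairs of distinct points of $\Lambda$, and let $m=d_\epsilon^{-2\delta/\epsilon}\,\nu\times\nu$ on $\Lambda^{(2)}$. Suppose that $\Gamma$ is a $2\frac12$-lattice: the Bowen–Margulis–Sullivan measure $m\times dt$ on $\Lambda^{(2)}\times\mathbb R$ induces on the quotient by the action $$\gamma(\xi,\eta,s)=\Bigl(\gamma\xi,\gamma\eta,\,s+\tfrac12\bigl(\beta_\xi(p,\gamma^{-1}p)-\beta_\eta(p,\gamma^{-1}p)\bigr)\Bigr)$$ a measure of positive finite total mass; the total mass is the least measure of a Borel set that meets each $\Gamma$-orbit in $\Lambda^{(2)}\times\mathbb R$. Let $d\Gamma\subset\mathrm{Homeo}(\partial X)$ be the image of $\Gamma$ under the boundary map, let $\psi:d\Gamma\to\mathrm{Homeo}(\Lambda)$ be the restriction to the limit set, and let $$H=\{f\in\mathrm{Homeo}(\Lambda): (f\times f)_*m=m\}$$ with the compact-open topology. **Theorem.** The image $\psi(d\Gamma)$ is contained in $H$ and is a lattice in $H$: $H$ is a locally compact Hausdorff topological group, $\psi(d\Gamma)$ is a discrete subgroup of $H$, and $H/\psi(d\Gamma)$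 carries a nonzero finite $H$-invariant Borel measure. -/

import Mathlib

open MeasureTheory Filter Topology
open scoped ENNReal

universe u

namespace CoarseLattice

/-! ### Gromov hyperbolic spaces and their boundaries -/

section Boundary

/-- The Gromov product `(x, y)_p`. -/
noncomputable def gromovProduct {X : Type*} [MetricSpace X] (p x y : X) : ℝ :=
  (dist p x + dist p y - dist x y) / 2

/-- Gromov hyperbolicity through the four-point condition (the space need not be geodesic, nor
proper, nor complete). -/
class GromovHyperbolic (X : Type*) [MetricSpace X] : Prop where
  exists_const : ∃ c : ℝ, ∀ p x y z : X,
    min (gromovProduct p x y) (gromovProduct p y z) - c ≤ gromovProduct p x z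

/-- A sequence converges to infinity if `(x_m, x_n)_p → ∞` as `m, n → ∞`. -/
def IsGromovSeq {X : Type*} [MetricSpace X] (x : ℕ → X) : Prop :=
  ∀ p : X, Tendsto (fun mn : ℕ × ℕ => gromovProduct p (x mn.1) (x mn.2)) atTop atTop

/-- Two sequences converging to infinity are equivalent if `(x_n, y_n)_p → ∞`. -/
def gromovSeqSetoid (X : Type*) [MetricSpace X] [GromovHyperbolic X] :
    Setoid {x : ℕ → X // IsGromovSeq x} where
  r x y := ∀ p : X, Tendsto (fun n => gromovProduct p (x.1 n) (y.1 n)) atTop atTop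
  iseqv :=
    { refl := fun x p => by
        have h : Tendsto (fun n : ℕ => (n, n)) atTop (atTop : Filter (ℕ × ℕ)) := by
          rw [← prod_atTop_atTop_eq]
          exact tendsto_id.prodMk tendsto_id
        exact (x.2 p).comp h
      symm := fun {x y} h p => by
        refine (h p).congr fun n => ?_
        simp only [gromovProduct, dist_comm (x.1 n) (y.1 n)]
        ring
      trans := fun {x y z} h k p => by
        obtain ⟨c, hc⟩ := GromovHyperbolic.exists_const (X := X)
        refine tendsto_atTop_mono (fun n => hc p (x.1 n) (y.1 n) (z.1 n)) ?_
        refine tendsto_atTop_add_const_right _ (-c) ?_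
        exact tendsto_atTop.2 fun b => by
          filter_upwards [tendsto_atTop.1 (h p) b, tendsto_atTop.1 (k p) b] with n h1 h2
          exact le_min h1 h2 }

/-- The Gromov boundary `∂X`: sequences converging to infinity modulo equivalence. -/
def GromovBoundary (X : Type u) [MetricSpace X] [GromovHyperbolic X] : Type u :=
  Quotient (gromovSeqSetoid X)

variable {X : Type*} [MetricSpace X] [GromovHyperbolic X]

/-- `x_n → ξ`: the sequence `x` converges to infinity and represents the boundary point `ξ`. -/
def ConvergesTo (x : ℕ → X) (ξ : GromovBoundary X) : Prop :=
  ∃ h : IsGromovSeq x, (Quotient.mk (gromovSeqSetoid X) ⟨x, h⟩ : GromovBoundary X) = ξ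

/-- The Gromov product of two boundary points, with values in `[0, ∞]`:
`inf liminf (x_n, y_n)_p` over the sequences `x_n → ξ`, `y_n → η`. In a good hyperbolic space the
limit exists and does not depend on the sequences. -/
noncomputable def boundaryProduct (p : X) (ξ η : GromovBoundary X) : ℝ≥0∞ :=
  ⨅ (x : ℕ → X) (_ : ConvergesTo x ξ) (y : ℕ → X) (_ : ConvergesTo y η),
    liminf (fun n => ENNReal.ofReal (gromovProduct p (x n) (y n))) atTop

/-- `d_ε(ξ, η) = exp (-ε (ξ, η)_p)`, with `exp (-∞) = 0`. -/
noncomputable def visualDist (p : X) (ε : ℝ) (ξ η : GromovBoundary X) : ℝ :=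
  if boundaryProduct p ξ η = ⊤ then 0 else Real.exp (-ε * (boundaryProduct p ξ η).toReal)

/-- Convergence of a sequence of points of `X` to a point of the bordification `X ∪ ∂X`. -/
def BordTendsto (x : ℕ → X) : X ⊕ GromovBoundary X → Prop
  | Sum.inl a => Tendsto x atTop (𝓝 a)
  | Sum.inr ξ => ConvergesTo x ξ

/-- `X` is `ε`-good: for each base point `p`, the Gromov product extends continuously to the
bordification, as a function with values in `[0, ∞]` (a continuous extension from the dense subset
`X × X` of the first countable space `(X ∪ ∂X) × (X ∪ ∂X)` exists exactly when the limits along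
sequences exist and depend only on the limit points), and `d_ε` is a metric on `∂X`. -/
structure IsGood (X : Type*) [MetricSpace X] [GromovHyperbolic X] (ε : ℝ) : Prop where
  extends_continuously : ∀ (p : X) (a b : X ⊕ GromovBoundary X), ∃ L : ℝ≥0∞,
    ∀ x y : ℕ → X, BordTendsto x a → BordTendsto y b →
      Tendsto (fun n => ENNReal.ofReal (gromovProduct p (x n) (y n))) atTop (𝓝 L)
  eq_zero_iff : ∀ (p : X) (ξ η : GromovBoundary X), visualDist p ε ξ η = 0 ↔ ξ = η
  symm : ∀ (p : X) (ξ η : GromovBoundary X), visualDist p ε ξ η = visualDist p ε η ξ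
  triangle : ∀ (p : X) (ξ η ζ : GromovBoundary X),
    visualDist p ε ξ ζ ≤ visualDist p ε ξ η + visualDist p ε η ζ

/-- The topology of `∂X`: `U` is open if around each of its points `ξ` it contains a set
`{η | (ξ, η)_p > t}`. In an `ε`-good space this is the topology of the metric `d_ε`, for each base
point `p`. -/
instance : TopologicalSpace (GromovBoundary X) where
  IsOpen U := ∀ p : X, ∀ ξ ∈ U, ∃ t : ℝ, ∀ η, ENNReal.ofReal t < boundaryProduct p ξ η → η ∈ U
  isOpen_univ := fun _ _ _ => ⟨0, fun _ _ => trivial⟩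
  isOpen_inter := fun U V hU hV p ξ hξ => by
    obtain ⟨s, hs⟩ := hU p ξ hξ.1
    obtain ⟨t, ht⟩ := hV p ξ hξ.2
    refine ⟨max s t, fun η hη => ⟨hs η (lt_of_le_of_lt ?_ hη), ht η (lt_of_le_of_lt ?_ hη)⟩⟩
    · exact ENNReal.ofReal_le_ofReal (le_max_left _ _)
    · exact ENNReal.ofReal_le_ofReal (le_max_right _ _)
  isOpen_sUnion := fun S hS p ξ hξ => by
    obtain ⟨U, hU, hξU⟩ := hξ
    obtain ⟨t, ht⟩ := hS U hU p ξ hξU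
    exact ⟨t, fun η hη => ⟨U, hU, ht η hη⟩⟩

instance : MeasurableSpace (GromovBoundary X) := borel _

instance : BorelSpace (GromovBoundary X) := ⟨rfl⟩

/-- The Busemann function `β_ξ(x, y) = lim_{z → ξ} (d(x, z) - d(y, z))`; in a good hyperbolic space
the limit exists and does not depend on the sequence `z → ξ`. -/
noncomputable def busemann (ξ : GromovBoundary X) (x y : X) : ℝ :=
  limUnder atTop fun n => dist x (ξ.out.1 n) - dist y (ξ.out.1 n)

theorem convergesTo_out (ξ : GromovBoundary X) : ConvergesTo ξ.out.1 ξ :=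
  ⟨ξ.out.2, Quotient.out_eq ξ⟩

theorem tendsto_busemann {ε : ℝ} (hX : IsGood X ε) {ξ : GromovBoundary X} {z : ℕ → X}
    (hz : ConvergesTo z ξ) (x y : X) :
    Tendsto (fun n => dist x (z n) - dist y (z n)) atTop (𝓝 (busemann ξ x y)) := by
  obtain ⟨L, hL⟩ := hX.extends_continuously x (Sum.inr ξ) (Sum.inl y)
  have key : ∀ w : ℕ → X, ConvergesTo w ξ →
      Tendsto (fun n => dist x (w n) - dist y (w n)) atTop
        (𝓝 (2 * L.toReal - dist x y)) := by
    intro w hw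
    have h1 := hL w (fun _ => y) hw tendsto_const_nhds
    have hLtop : L ≠ ⊤ := by
      have h2 : L ≤ ENNReal.ofReal (dist x y) := by
        refine le_of_tendsto' h1 fun n => ENNReal.ofReal_le_ofReal ?_
        have := dist_triangle x y (w n)
        have := dist_comm y (w n)
        simp only [gromovProduct]
        linarith
      exact ne_top_of_le_ne_top ENNReal.ofReal_ne_top h2
    have h3 := ((ENNReal.tendsto_toReal hLtop).comp h1).const_mul 2 |>.sub_const (dist x y)
    refine h3.congr fun n => ?_
    have h4 : 0 ≤ gromovProduct x (w n) y := by
      have := dist_triangle (w n) x y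
      have := dist_comm (w n) x
      simp only [gromovProduct]
      linarith
    simp only [Function.comp, ENNReal.toReal_ofReal h4]
    simp only [gromovProduct, dist_comm (w n) y]
    ring
  have h5 : busemann ξ x y = 2 * L.toReal - dist x y := (key _ (convergesTo_out ξ)).limUnder_eq
  rw [h5]
  exact key z hz

/-! ### The boundary map of an isometry -/

theorem gromovProduct_map {X : Type*} [MetricSpace X] (g : X ≃ᵢ X) (p x y : X) :
    gromovProduct (g p) (g x) (g y) = gromovProduct p x y := by
  simp only [gromovProduct, g.dist_eq]

theorem gromovProduct_map' {X : Type*} [MetricSpace X] (g : X ≃ᵢ X) (p x y : X) :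
    gromovProduct p (g x) (g y) = gromovProduct (g.symm p) x y := by
  rw [← gromovProduct_map g (g.symm p), g.apply_symm_apply]

theorem IsGromovSeq.map {X : Type*} [MetricSpace X] (g : X ≃ᵢ X) {x : ℕ → X} (hx : IsGromovSeq x) :
    IsGromovSeq fun n => g (x n) := fun p => by
  simpa only [gromovProduct_map'] using hx (g.symm p)

/-- The boundary map of an isometry: the class of `x_n` goes to the class of `g x_n`. -/
def boundaryMap (g : X ≃ᵢ X) : GromovBoundary X → GromovBoundary X :=
  Quotient.map' (s₁ := gromovSeqSetoid X) (s₂ := gromovSeqSetoid X)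
    (fun x => ⟨fun n => g (x.1 n), x.2.map g⟩) fun x y h p => by
      have := h (g.symm p)
      simpa only [gromovProduct_map'] using this

theorem boundaryMap_one (ξ : GromovBoundary X) : boundaryMap (1 : X ≃ᵢ X) ξ = ξ :=
  Quotient.inductionOn ξ fun _ => rfl

theorem boundaryMap_mul (g h : X ≃ᵢ X) (ξ : GromovBoundary X) :
    boundaryMap (g * h) ξ = boundaryMap g (boundaryMap h ξ) :=
  Quotient.inductionOn ξ fun _ => rfl

theorem ConvergesTo.map (g : X ≃ᵢ X) {x : ℕ → X} {ξ : GromovBoundary X} (h : ConvergesTo x ξ) :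
    ConvergesTo (fun n => g (x n)) (boundaryMap g ξ) := by
  obtain ⟨hx, rfl⟩ := h
  exact ⟨hx.map g, rfl⟩

theorem le_boundaryProduct_map (g : X ≃ᵢ X) (p : X) (ξ η : GromovBoundary X) :
    boundaryProduct (g p) (boundaryMap g ξ) (boundaryMap g η) ≤ boundaryProduct p ξ η := by
  refine le_iInf₂ fun x hx => le_iInf₂ fun y hy => ?_
  refine (iInf₂_le (fun n => g (x n)) (hx.map g)).trans
    ((iInf₂_le (fun n => g (y n)) (hy.map g)).trans (le_of_eq ?_))
  simp only [gromovProduct_map]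

theorem continuous_boundaryMap (g : X ≃ᵢ X) :
    Continuous (boundaryMap g : GromovBoundary X → GromovBoundary X) := by
  refine ⟨fun U hU p ξ hξ => ?_⟩
  obtain ⟨t, ht⟩ := hU (g p) (boundaryMap g ξ) hξ
  refine ⟨t, fun η hη => ht _ (lt_of_lt_of_le hη ?_)⟩
  have h := le_boundaryProduct_map g⁻¹ (g p) (boundaryMap g ξ) (boundaryMap g η)
  rw [← boundaryMap_mul, ← boundaryMap_mul, inv_mul_cancel, boundaryMap_one, boundaryMap_one] at h
  have e : g⁻¹ (g p) = p := g.symm_apply_apply p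
  rwa [e] at h

/-- The boundary map `d : Isom(X) → Homeo(∂X)`. -/
def boundaryHom : (X ≃ᵢ X) →* (GromovBoundary X ≃ₜ GromovBoundary X) where
  toFun g :=
    { toFun := boundaryMap g
      invFun := boundaryMap g⁻¹
      left_inv := fun ξ => by rw [← boundaryMap_mul, inv_mul_cancel, boundaryMap_one]
      right_inv := fun ξ => by rw [← boundaryMap_mul, mul_inv_cancel, boundaryMap_one]
      continuous_toFun := continuous_boundaryMap g
      continuous_invFun := continuous_boundaryMap g⁻¹ }
  map_one' := Homeomorph.ext boundaryMap_one
  map_mul' g h := Homeomorph.ext (boundaryMap_mul g h)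

theorem boundaryHom_apply (g : X ≃ᵢ X) (ξ : GromovBoundary X) :
    boundaryHom g ξ = boundaryMap g ξ := rfl

/-! ### Discrete groups of isometries, limit sets, Poincaré series -/

/-- The action of `Γ` is metrically proper. -/
def MetricallyProper (Γ : Subgroup (X ≃ᵢ X)) : Prop :=
  ∀ (x : X) (R : ℝ), {γ : Γ | dist x (γ.1 x) < R}.Finite

/-- The limit set `ΛΓ`: the boundary points that are limits of sequences in an orbit of `Γ`. -/
def limitSet (Γ : Subgroup (X ≃ᵢ X)) : Set (GromovBoundary X) :=
  {ξ | ∃ (x : X) (g : ℕ → Γ), ConvergesTo (fun n => (g n).1 x) ξ}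

theorem boundaryHom_mem_limitSet {Γ : Subgroup (X ≃ᵢ X)} {g : X ≃ᵢ X} (hg : g ∈ Γ)
    {ξ : GromovBoundary X} (hξ : ξ ∈ limitSet Γ) : boundaryHom g ξ ∈ limitSet Γ := by
  obtain ⟨x, h, hx⟩ := hξ
  rw [boundaryHom_apply]
  refine ⟨x, fun n => ⟨g * (h n).1, Γ.mul_mem hg (h n).2⟩, ?_⟩
  exact ConvergesTo.map g hx

/-- `dΓ`, the image of `Γ` in `Homeo(∂X)`. -/
def boundaryGroup (Γ : Subgroup (X ≃ᵢ X)) : Subgroup (GromovBoundary X ≃ₜ GromovBoundary X) :=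
  Γ.map boundaryHom

theorem mem_limitSet_iff {Γ : Subgroup (X ≃ᵢ X)} {f : GromovBoundary X ≃ₜ GromovBoundary X}
    (hf : f ∈ boundaryGroup Γ) (ξ : GromovBoundary X) : ξ ∈ limitSet Γ ↔ f ξ ∈ limitSet Γ := by
  obtain ⟨g, hg, rfl⟩ := hf
  refine ⟨boundaryHom_mem_limitSet hg, fun h => ?_⟩
  have h' := boundaryHom_mem_limitSet (Γ.inv_mem hg) h
  rwa [← Homeomorph.mul_apply, ← map_mul, inv_mul_cancel, map_one, Homeomorph.one_apply] at h'

/-- The restriction `ψ : dΓ → Homeo(ΛΓ)`. -/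
def restrictHom (Γ : Subgroup (X ≃ᵢ X)) : boundaryGroup Γ →* (limitSet Γ ≃ₜ limitSet Γ) where
  toFun f := f.1.subtype (mem_limitSet_iff f.2)
  map_one' := rfl
  map_mul' _ _ := rfl

/-- The element of `Homeo(ΛΓ)` given by `γ ∈ Γ`. -/
def limitHomeo (Γ : Subgroup (X ≃ᵢ X)) (γ : Γ) : limitSet Γ ≃ₜ limitSet Γ :=
  restrictHom Γ ⟨boundaryHom γ.1, γ.1, γ.2, rfl⟩

/-- The Poincaré series `∑_γ exp (-s d(p, γp))`. -/
noncomputable def poincareSeries (Γ : Subgroup (X ≃ᵢ X)) (p : X) (s : ℝ) : ℝ≥0∞ :=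
  ∑' γ : Γ, ENNReal.ofReal (Real.exp (-s * dist p (γ.1 p)))

/-- The critical exponent `δ_Γ = inf {s ≥ 0 : ∑_γ exp (-s d(p, γp)) < ∞} ∈ [0, ∞]`. -/
noncomputable def criticalExponent (Γ : Subgroup (X ≃ᵢ X)) (p : X) : ℝ≥0∞ :=
  ⨅ (s : ℝ) (_ : 0 ≤ s ∧ poincareSeries Γ p s < ⊤), ENNReal.ofReal s

/-! ### Patterson–Sullivan and Bowen–Margulis–Sullivan measures -/

/-- `ν` is a Patterson–Sullivan measure of dimension `δ` on `ΛΓ`: a Borel probability measure that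
is conformal, that is `d(γ⁻¹)_*ν / dν (ξ) = exp (δ β_ξ(p, γ⁻¹p)) = γ'(ξ) ^ (δ / ε)`. -/
structure IsPattersonSullivan (Γ : Subgroup (X ≃ᵢ X)) (p : X) (δ : ℝ)
    (ν : Measure (limitSet Γ)) : Prop where
  isProbabilityMeasure : IsProbabilityMeasure ν
  conformal : ∀ γ : Γ, ν.map (limitHomeo Γ γ⁻¹) =
    ν.withDensity fun ξ => ENNReal.ofReal (Real.exp (δ * busemann ξ.1 p (γ.1⁻¹ p)))

/-- The measure `d_ε ^ (-2δ/ε) ν × ν` on the space of pairs of distinct points of `ΛΓ`, regarded as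
a measure on `ΛΓ × ΛΓ` that vanishes on the diagonal. -/
noncomputable def pairMeasure (Γ : Subgroup (X ≃ᵢ X)) (p : X) (ε δ : ℝ)
    (ν : Measure (limitSet Γ)) : Measure (limitSet Γ × limitSet Γ) :=
  ((ν.prod ν).restrict {z | z.1 ≠ z.2}).withDensity
    fun z => ENNReal.ofReal (visualDist p ε z.1.1 z.2.1 ^ (-(2 * δ / ε)))

/-- The Bowen–Margulis–Sullivan measure `d_ε ^ (-2δ/ε) ν × ν × dt`. -/
noncomputable def bmsMeasure (Γ : Subgroup (X ≃ᵢ X)) (p : X) (ε δ : ℝ)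
    (ν : Measure (limitSet Γ)) : Measure ((limitSet Γ × limitSet Γ) × ℝ) :=
  (pairMeasure Γ p ε δ ν).prod volume

/-- The action of `Γ` on pairs of limit points times `ℝ`:
`γ (ξ, η, s) = (γξ, γη, s + (β_ξ(p, γ⁻¹p) - β_η(p, γ⁻¹p)) / 2)`. -/
noncomputable def flowAct (Γ : Subgroup (X ≃ᵢ X)) (p : X) (γ : Γ)
    (z : (limitSet Γ × limitSet Γ) × ℝ) : (limitSet Γ × limitSet Γ) × ℝ :=
  ((limitHomeo Γ γ z.1.1, limitHomeo Γ γ z.1.2),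
    z.2 + (busemann z.1.1.1 p (γ.1⁻¹ p) - busemann z.1.2.1 p (γ.1⁻¹ p)) / 2)

/-- The total mass of the quotient of the Bowen–Margulis–Sullivan measure by `Γ`: the least measure
of a Borel set that meets the `Γ`-orbit of each `(ξ, η, s)` with `ξ ≠ η` (attained by the Borel
sets that meet each orbit exactly once). -/
noncomputable def bmsMass (Γ : Subgroup (X ≃ᵢ X)) (p : X) (ε δ : ℝ)
    (ν : Measure (limitSet Γ)) : ℝ≥0∞ :=
  ⨅ (F : Set ((limitSet Γ × limitSet Γ) × ℝ)) (_ : MeasurableSet F)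
    (_ : ∀ z : (limitSet Γ × limitSet Γ) × ℝ, z.1.1 ≠ z.1.2 → ∃ γ : Γ, flowAct Γ p γ z ∈ F),
    bmsMeasure Γ p ε δ ν F

/-- `Γ` is a `2½`-lattice: the quotient of the Bowen–Margulis–Sullivan measure by `Γ` is finite and
nonzero. -/
def IsTwoAndAHalfLattice (Γ : Subgroup (X ≃ᵢ X)) (p : X) (ε δ : ℝ)
    (ν : Measure (limitSet Γ)) : Prop :=
  0 < bmsMass Γ p ε δ ν ∧ bmsMass Γ p ε δ ν < ⊤

end Boundary

/-! ### Homeomorphism groups and lattices -/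

section Lattice

/-- The compact-open topology on the homeomorphism group; for a compact metric space it is the
topology of uniform convergence. -/
instance homeoTopology (Y : Type*) [TopologicalSpace Y] : TopologicalSpace (Y ≃ₜ Y) :=
  TopologicalSpace.induced (fun f => (⟨f, f.continuous⟩ : C(Y, Y))) inferInstance

/-- The group `H` of homeomorphisms of `ΛΓ` that preserve `d_ε ^ (-2δ/ε) ν × ν`. -/
def preservingGroup {X : Type*} [MetricSpace X] [GromovHyperbolic X] (Γ : Subgroup (X ≃ᵢ X))
    (p : X) (ε δ : ℝ) (ν : Measure (limitSet Γ)) : Subgroup (limitSet Γ ≃ₜ limitSet Γ) where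
  carrier := {f | (pairMeasure Γ p ε δ ν).map (Prod.map f f) = pairMeasure Γ p ε δ ν}
  one_mem' := Measure.map_id
  mul_mem' {f g} hf hg := by
    have h := Measure.map_map (μ := pairMeasure Γ p ε δ ν)
      (f.measurable.prodMap f.measurable) (g.measurable.prodMap g.measurable)
    have h' : Prod.map ⇑(f * g) ⇑(f * g) = Prod.map f f ∘ Prod.map g g := rfl
    rw [Set.mem_ofPred_eq] at hf hg ⊢
    rw [h', ← h, hg, hf]
  inv_mem' {f} hf := by
    have h := Measure.map_map (μ := pairMeasure Γ p ε δ ν)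
      ((f⁻¹).measurable.prodMap (f⁻¹).measurable) (f.measurable.prodMap f.measurable)
    have h' : Prod.map ⇑f⁻¹ ⇑f⁻¹ ∘ Prod.map f f = id := by
      funext z
      exact Prod.ext (f.symm_apply_apply z.1) (f.symm_apply_apply z.2)
    rw [Set.mem_ofPred_eq] at hf ⊢
    rw [hf, h', Measure.map_id] at h
    exact h

/-- `L` is a lattice in `G`: `G` is a locally compact Hausdorff topological group, `L` is discrete,
and `G / L` carries a nonzero finite `G`-invariant Borel measure. -/
structure IsLattice {G : Type*} [Group G] [TopologicalSpace G] (L : Subgroup G) : Prop where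
  isTopologicalGroup : IsTopologicalGroup G
  t2Space : T2Space G
  locallyCompactSpace : LocallyCompactSpace G
  discreteTopology : DiscreteTopology L
  exists_invariant_measure : ∃ μ : @Measure (G ⧸ L) (borel (G ⧸ L)),
    μ ≠ 0 ∧ μ Set.univ < ⊤ ∧
      ∀ g : G, @Measure.map (G ⧸ L) (G ⧸ L) (borel _) (borel _) (fun x => g • x) μ = μ

end Lattice

end CoarseLattice

/-! Write a = 2δ/ε and d for the visual metric, so that m = d^(-a) ν × ν. The point is that the
measure m remembers the metric up to Möbius maps.

Rigidity. Unless m = 0, the measure ν charges every nonempty open subset of Λ: of two distinct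
boundary points, Γ moves at least one into any given open set that meets Λ. On products of small
sets about x ≠ y, the ratio of m to ν × ν tends to d(x,y)^(-a). In a cross ratio the ν-masses
cancel, so each f in H preserves cross ratios (`crossRatio_eq_of_map_offDiagMeasure`). Hence f has a
conformal factor φ > 0 with d(fx,fy)² = φ(x)φ(y)d(x,y)².

Local compactness. Upper bounds on the conformal factors of f and its inverse give Lipschitz bounds.
By Arzelà–Ascoli, the elements of H that are C-Lipschitz together with their inverses form a compact
set (`isCompact_lipschitzPart`), and for some C it is a neighbourhood of 1. Only finitely many
elements of the image of Γ lie in it, since a lower bound on the factors of γ at two boundary points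
bounds d(p,γp). So the image is discrete.

Finite covolume. With the cocycle log(φ(x)/φ(y))/(2ε), the action of Γ on Λ⁽²⁾ × ℝ extends to an
action of H that preserves m × dt. For K the set of (x,y,s) with d(x,y) ≥ r and |s| ≤ 1, the
elements of H that return a point of K to K lie in one of these compact sets. Integrating 1_F(z)
1_K(gz) over H × Λ⁽²⁾ × ℝ in both orders, with F a set of finite measure that meets the Γ-orbits,
bounds the Haar measure of a fundamental domain (`haar_inv_fundamentalDomain_lt_top`).

If Λ has fewer than three points, conformal factors are not unique, but then H is finite. -/

namespace CoarseLattice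

/-! ### Fundamental domains and finite covolume for discrete subgroups -/

section Group

variable {G : Type*} [Group G] [TopologicalSpace G] [IsTopologicalGroup G]
  [SecondCountableTopology G] [MeasurableSpace G] [BorelSpace G]

/-- Near 1 there is an open V with V⁻¹V ∩ L = {1}, so every translate gV injects into G / L.
Countably many translates g_n V cover G; the domain takes from g_n V the points whose coset meets no
earlier translate. -/
theorem exists_measurable_fundamentalDomain (L : Subgroup G) [DiscreteTopology L] :
    ∃ D : Set G, MeasurableSet D ∧ ∀ x : G, ∃! l : L.op, l • x ∈ D := by
  classical
  obtain ⟨V, hV, hVL⟩ : ∃ V ∈ 𝓝 (1 : G), ∀ u ∈ V, ∀ v ∈ V, u⁻¹ * v ∈ L → u⁻¹ * v = 1 := by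
    obtain ⟨U, hU, hUL⟩ : ∃ U : Set G, IsOpen U ∧ ((↑) : L → G) ⁻¹' U = {1} :=
      isOpen_induced_iff.1 (isOpen_discrete ({1} : Set L))
    have h1 : (1 : G) ∈ U := by
      have : (1 : L) ∈ ((↑) : L → G) ⁻¹' U := by rw [hUL]; rfl
      exact this
    have hc : Tendsto (fun z : G × G => z.1⁻¹ * z.2) (𝓝 1 ×ˢ 𝓝 1) (𝓝 1) := by
      have : ContinuousAt (fun z : G × G => z.1⁻¹ * z.2) (1, 1) := by fun_prop
      simpa [ContinuousAt, nhds_prod_eq] using this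
    obtain ⟨V, hV, hVU⟩ := mem_prod_same_iff.1 (hc (hU.mem_nhds h1))
    refine ⟨V, hV, fun u hu v hv hl => ?_⟩
    have h2 : (⟨u⁻¹ * v, hl⟩ : L) ∈ ((↑) : L → G) ⁻¹' U := hVU (Set.mk_mem_prod hu hv)
    rw [hUL] at h2
    exact congrArg Subtype.val h2
  wlog hVo : IsOpen V generalizing V
  · exact this (interior V) (interior_mem_nhds.2 hV)
      (fun u hu v hv => hVL u (interior_subset hu) v (interior_subset hv)) isOpen_interior
  set g := TopologicalSpace.denseSeq G
  let B : ℕ → Set G := fun n => (fun x => (g n)⁻¹ * x) ⁻¹' V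
  have hB : ∀ n, IsOpen (B n) := fun n => hVo.preimage (by fun_prop)
  let W : ℕ → Set G := fun n => ⋃ l : L, (fun x => x * (l : G)) ⁻¹' B n
  have hW : ∀ n, IsOpen (W n) := fun n =>
    isOpen_iUnion fun l => (hB n).preimage (by fun_prop)
  have hWl : ∀ n x (l : L), x * (l : G) ∈ W n → x ∈ W n := by
    intro n x l h
    obtain ⟨k, hk⟩ := Set.mem_iUnion.1 h
    exact Set.mem_iUnion.2 ⟨l * k, by simpa [mul_assoc] using hk⟩
  have hcov : ∀ x, ∃ n, x ∈ W n := by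
    intro x
    obtain ⟨n, hn⟩ := (TopologicalSpace.denseRange_denseSeq G).exists_mem_open
      (s := (fun y => y⁻¹ * x) ⁻¹' V) (hVo.preimage (by fun_prop))
      ⟨x, by simpa using mem_of_mem_nhds hV⟩
    exact ⟨n, Set.mem_iUnion.2 ⟨1, by simpa [B, g] using hn⟩⟩
  refine ⟨⋃ n, B n \ ⋃ j ∈ Finset.range n, W j, ?_, fun x => ?_⟩
  · exact MeasurableSet.iUnion fun n => (hB n).measurableSet.diff
      (Finset.measurableSet_biUnion _ fun j _ => (hW j).measurableSet)
  -- A point of the coset xL in the domain can only come from the least n for which the coset meets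
  -- g_n V; injectivity of V on cosets then gives uniqueness.
  · have hmem : ∀ l : L, x * (l : G) ∈ (⋃ n, B n \ ⋃ j ∈ Finset.range n, W j) →
        x * (l : G) ∈ B (Nat.find (hcov x)) := by
      intro l hl
      obtain ⟨n, hn, hn'⟩ := Set.mem_iUnion.1 hl
      have h1 : Nat.find (hcov x) ≤ n := Nat.find_min' _ (Set.mem_iUnion.2 ⟨l, hn⟩)
      rcases h1.lt_or_eq with h2 | h2
      · refine absurd ?_ hn'
        refine Set.mem_biUnion (Finset.mem_coe.2 (Finset.mem_range.2 h2)) ?_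
        refine hWl _ _ l⁻¹ ?_
        simpa using Nat.find_spec (hcov x)
      · rwa [h2]
    obtain ⟨l, hl⟩ := Set.mem_iUnion.1 (Nat.find_spec (hcov x))
    refine ⟨⟨MulOpposite.op (l : G), l.2⟩, ?_, ?_⟩
    · refine Set.mem_iUnion.2 ⟨Nat.find (hcov x), hl, fun h => ?_⟩
      obtain ⟨j, hj, hj'⟩ := Set.mem_iUnion₂.1 h
      exact Nat.find_min (hcov x) (Finset.mem_range.1 hj) (hWl _ _ l hj')
    · rintro ⟨k, hk⟩ hkx
      have h1 := hmem ⟨k.unop, hk⟩ hkx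
      have h2 := hVL _ hl _ h1 (by
        have : (l : G)⁻¹ * k.unop ∈ L := L.mul_mem (L.inv_mem l.2) hk
        simpa [mul_assoc] using this)
      have h3 : (l : G)⁻¹ * k.unop = 1 := by simpa [mul_assoc] using h2
      refine Subtype.ext (MulOpposite.unop_injective ?_)
      exact (inv_mul_eq_one.1 h3).symm

variable [LocallyCompactSpace G]

/-- Inversion turns left multiplication by g into right multiplication by g⁻¹, which scales left
Haar measure by the modular function. The inverted measure is the one to use because it is right
invariant, hence invariant under the right action of L. Unimodularity is not known in advance. -/
theorem exists_map_mul_left_haar_inv (g : G) :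
    ∃ c : ENNReal, Measure.map (g * ·) (Measure.haar : Measure G).inv =
      c • (Measure.haar : Measure G).inv := by
  refine ⟨(Measure.modularCharacterFun g⁻¹ : NNReal), ?_⟩
  have h := Measure.map_right_mul_eq_modularCharacterFun_smul (Measure.haar : Measure G) g⁻¹
  rw [Measure.inv, Measure.map_map (by fun_prop) (by fun_prop)]
  have h1 : (fun x : G => g * x) ∘ Inv.inv = Inv.inv ∘ (fun x : G => x * g⁻¹) := by
    funext x; simp
  rw [h1, ← Measure.map_map (by fun_prop) (by fun_prop), h, Measure.map_smul]
  rfl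

/-- The measure is the image of the inverted Haar measure ρ on D. The translate gD is again a
fundamental domain, and all fundamental domains give the same measure to right L-invariant sets, so
translation by g scales the image measure by a constant. Finiteness of the total mass forces the
constant to be 1. -/
theorem exists_invariant_measure_of_fundamentalDomain (L : Subgroup G) [Countable L] {D : Set G}
    (hD : MeasurableSet D) (hDL : ∀ x : G, ∃! l : L.op, l • x ∈ D)
    (hfin : (Measure.haar : Measure G).inv D < ⊤) :
    ∃ μ : @Measure (G ⧸ L) (borel (G ⧸ L)), μ ≠ 0 ∧ μ Set.univ < ⊤ ∧
      ∀ g : G, @Measure.map (G ⧸ L) (G ⧸ L) (borel _) (borel _) (fun x => g • x) μ = μ := by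
  borelize (G ⧸ L)
  set ρ := (Measure.haar : Measure G).inv with hρ
  have : Countable L.op := (Subgroup.equivOp L).symm.injective.countable
  have hfund : IsFundamentalDomain L.op D ρ := .mk' hD.nullMeasurableSet hDL
  have hmk : Measurable (QuotientGroup.mk : G → G ⧸ L) :=
    (continuous_quotient_mk' : Continuous _).measurable
  have hρ0 : ρ ≠ 0 := by
    intro h
    have h1 : ρ Set.univ = 0 := by simp [h]
    rw [hρ, Measure.inv_apply, Set.inv_univ] at h1
    exact isOpen_univ.measure_ne_zero Measure.haar ⟨(1 : G), trivial⟩ h1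
  have hD0 : ρ D ≠ 0 := hfund.measure_ne_zero hρ0
  refine ⟨Measure.map QuotientGroup.mk (ρ.restrict D), ?_, ?_, fun g => ?_⟩
  · intro h
    have h1 := congrArg (fun m => m Set.univ) h
    simp only [Measure.map_apply hmk MeasurableSet.univ] at h1
    simp at h1
    exact hD0 h1
  · rw [Measure.map_apply hmk MeasurableSet.univ]
    simpa using hfin
  · obtain ⟨c, hc⟩ := exists_map_mul_left_haar_inv g
    rw [← hρ] at hc
    have hgD : MeasurableSet ((g⁻¹ * ·) ⁻¹' D) := measurable_const_mul g⁻¹ hD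
    have hfund' : IsFundamentalDomain L.op ((g⁻¹ * ·) ⁻¹' D) ρ := by
      refine .mk' hgD.nullMeasurableSet fun x => ?_
      obtain ⟨l, hl, hl'⟩ := hDL (g⁻¹ * x)
      refine ⟨l, ?_, fun k hk => hl' k ?_⟩
      · simpa [Subgroup.smul_def, mul_assoc] using hl
      · simpa [Subgroup.smul_def, mul_assoc] using hk
    have key : ∀ A : Set (G ⧸ L), MeasurableSet A →
        ρ (D ∩ (fun x => ((g * x : G) : G ⧸ L)) ⁻¹' A) = c * ρ (D ∩ QuotientGroup.mk ⁻¹' A) := by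
      intro A hA
      have h1 := congrArg (fun m => m (((g⁻¹ * ·) ⁻¹' D) ∩ QuotientGroup.mk ⁻¹' A)) hc
      simp only [Measure.smul_apply, smul_eq_mul] at h1
      rw [Measure.map_apply (measurable_const_mul g) (hgD.inter (hmk hA))] at h1
      have h2 := hfund'.measure_set_eq hfund (hmk hA) fun l => by
        ext x
        have : ((l • x : G) : G ⧸ L) = (x : G ⧸ L) := by
          refine QuotientGroup.eq.2 ?_
          have : (l • x)⁻¹ * x = (l.1.unop)⁻¹ := by simp [Subgroup.smul_def]
          rw [this]
          exact L.inv_mem l.2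
        simp [this]
      rw [Set.inter_comm _ D] at h2
      rw [Set.inter_comm (_ ⁻¹' D), h2, Set.inter_comm] at h1
      rw [← h1]
      congr 1
      ext x
      simp
    have hc1 : c = 1 := by
      have h1 := key Set.univ MeasurableSet.univ
      simp only [Set.preimage_univ, Set.inter_univ] at h1
      have := (ENNReal.mul_eq_right hD0 hfin.ne).1 h1.symm
      exact this
    have hsm : Measurable (fun x : G ⧸ L => g • x) := (continuous_const_smul g).measurable
    refine Measure.ext fun A hA => ?_
    rw [Measure.map_apply hsm hA, Measure.map_apply hmk (hsm hA), Measure.map_apply hmk hA,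
      Measure.restrict_apply (hmk (hsm hA)), Measure.restrict_apply (hmk hA)]
    have h1 := key A hA
    rw [hc1, one_mul] at h1
    rw [Set.inter_comm _ D, Set.inter_comm _ D, ← h1]
    rfl

/-- A discrete subgroup `L` has finite covolume as soon as `G` acts, measurably and preserving
a measure, on a space with a set of finite measure that meets each `L`-orbit, and a set of positive
measure whose return times are relatively compact. -/
theorem haar_inv_fundamentalDomain_lt_top {Z : Type*} [MeasurableSpace Z] (M : Measure Z) [SFinite M]
    (T : G → Z → Z) (hTmul : ∀ g h z, T (g * h) z = T g (T h z))
    (hTm : Measurable (Function.uncurry T)) (hTp : ∀ g, MeasurePreserving (T g) M M)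
    (L : Subgroup G) [Countable L] {D : Set G}
    (hD : MeasurableSet D) (hDL : ∀ x : G, ∃! l : L.op, l • x ∈ D)
    {F K : Set Z} (hF : MeasurableSet F) (hK : MeasurableSet K) (hFfin : M F < ⊤) (hK0 : M K ≠ 0)
    (hFL : ∀ᵐ z ∂M, ∃ l ∈ L, T l z ∈ F) {C : Set G} (hC : IsCompact C)
    (hKC : ∀ g, ∀ z ∈ K, T g z ∈ K → g ∈ C) :
    (Measure.haar : Measure G).inv D < ⊤ := by
  set ρ := (Measure.haar : Measure G).inv with hρ
  have : Countable L.op := (Subgroup.equivOp L).symm.injective.countable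
  have hfund : IsFundamentalDomain L.op D ρ := .mk' hD.nullMeasurableSet hDL
  have hTg : ∀ g, Measurable (T g) := fun g => hTm.comp measurable_prodMk_left
  have hCfin : ρ C < ⊤ := by
    rw [hρ, Measure.inv_apply]
    exact (hC.inv).measure_lt_top
  -- If g₀z lies in K, then every g with gz in K satisfies gg₀⁻¹ ∈ C; right invariance of ρ does the
  -- rest.
  have hret : ∀ z, ρ {g | T g z ∈ K} ≤ ρ C := by
    intro z
    by_cases h : ∃ g, T g z ∈ K
    · obtain ⟨g₀, hg₀⟩ := h
      rw [← measure_preimage_mul_right ρ g₀]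
      refine measure_mono fun g hg => hKC g _ hg₀ ?_
      rw [← hTmul]
      exact hg
    · have : {g | T g z ∈ K} = ∅ := Set.eq_empty_of_forall_notMem fun g hg => h ⟨g, hg⟩
      simp [this]
  let f : G → Z → ℝ≥0∞ := fun g z => F.indicator 1 z * K.indicator 1 (T g z)
  have hf : Measurable (Function.uncurry f) :=
    ((measurable_one.indicator hF).comp measurable_snd).mul
      ((measurable_one.indicator hK).comp hTm)
  have hup : ∫⁻ g, ∫⁻ z, f g z ∂M ∂ρ ≤ ρ C * M F := by
    rw [lintegral_lintegral_swap hf.aemeasurable]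
    have h1 : ∀ z, ∫⁻ g, f g z ∂ρ ≤ F.indicator (fun _ => ρ C) z := by
      intro z
      by_cases hz : z ∈ F
      · have : ∀ g, f g z = {g | T g z ∈ K}.indicator 1 g := fun g => by
          simp only [f, Set.indicator_of_mem hz, Pi.one_apply, one_mul]
          rfl
        simp only [this, Set.indicator_of_mem hz]
        rw [lintegral_indicator_one]
        · exact hret z
        · exact (hTm.comp measurable_prodMk_right) hK
      · simp [f, hz]
    refine (lintegral_mono h1).trans ?_
    rw [lintegral_indicator_const hF]
  have hlow : ρ D * M K ≤ ∫⁻ g, ∫⁻ z, f g z ∂M ∂ρ := by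
    rw [hfund.lintegral_eq_tsum'' , ← lintegral_tsum]
    · have h1 : ∀ g, M K ≤ ∑' l : L.op, ∫⁻ z, f (l • g) z ∂M := by
        intro g
        -- Substituting l⁻¹z for z moves l from the K-factor to the F-factor; the sum over l of the
        -- F-factors is then at least 1 almost everywhere, because F meets almost every L-orbit.
        have h2 : ∀ l : L.op, ∫⁻ z, f (l • g) z ∂M =
            ∫⁻ z, F.indicator 1 (T l.1.unop⁻¹ z) * K.indicator 1 (T g z) ∂M := by
          intro l
          have hfl : Measurable (f (l • g)) := hf.comp measurable_prodMk_left
          rw [← (hTp l.1.unop⁻¹).lintegral_comp hfl]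
          refine lintegral_congr fun z => ?_
          simp only [f, ← hTmul, Subgroup.smul_def]
          congr 3
          change g * l.1.unop * l.1.unop⁻¹ = g
          simp
        simp only [h2]
        rw [← lintegral_tsum]
        · have h3 : M K = ∫⁻ z, K.indicator 1 (T g z) ∂M := by
            rw [(hTp g).lintegral_comp (measurable_one.indicator hK), lintegral_indicator_one hK]
          rw [h3]
          refine lintegral_mono_ae (hFL.mono fun z hz => ?_)
          obtain ⟨l, hl, hlz⟩ := hz
          refine le_trans ?_ (ENNReal.le_tsum
            (⟨MulOpposite.op l⁻¹, by simpa using hl⟩ : L.op))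
          simp [hlz]
        · intro l
          exact (((measurable_one.indicator hF).comp (hTg _)).mul
            ((measurable_one.indicator hK).comp (hTg _))).aemeasurable
      calc ρ D * M K = ∫⁻ _ in D, M K ∂ρ := by rw [setLIntegral_const, mul_comm]
        _ ≤ _ := lintegral_mono h1
    · intro l
      exact (hf.lintegral_prod_right'.comp (measurable_const_smul l)).aemeasurable
  have h : ρ D * M K < ⊤ := (hlow.trans hup).trans_lt (ENNReal.mul_lt_top hCfin hFfin)
  exact lt_top_iff_ne_top.2 fun h' => by
    rw [h', ENNReal.top_mul hK0] at h
    exact lt_irrefl _ h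

end Group

/-! ### The homeomorphism group of a compact space -/

section Homeo

variable {Y : Type*} [TopologicalSpace Y]

/-- A homeomorphism as a continuous map. -/
def homeoToContinuousMap (f : Y ≃ₜ Y) : C(Y, Y) := ⟨f, f.continuous⟩

theorem isInducing_homeoToContinuousMap :
    IsInducing (homeoToContinuousMap : (Y ≃ₜ Y) → C(Y, Y)) := ⟨rfl⟩

theorem continuous_homeoToContinuousMap :
    Continuous (homeoToContinuousMap : (Y ≃ₜ Y) → C(Y, Y)) :=
  isInducing_homeoToContinuousMap.continuous

theorem isEmbedding_homeoToContinuousMap :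
    IsEmbedding (homeoToContinuousMap : (Y ≃ₜ Y) → C(Y, Y)) :=
  ⟨isInducing_homeoToContinuousMap, fun _ _ h => Homeomorph.ext fun y => DFunLike.congr_fun h y⟩

instance homeo_t2Space [T2Space Y] : T2Space (Y ≃ₜ Y) := isEmbedding_homeoToContinuousMap.t2Space

theorem continuous_homeo_eval [LocallyCompactSpace Y] :
    Continuous fun z : (Y ≃ₜ Y) × Y => z.1 z.2 :=
  (continuous_eval (F := C(Y, Y))).comp (continuous_homeoToContinuousMap.prodMap continuous_id)

instance homeo_isTopologicalGroup [CompactSpace Y] [T2Space Y] : IsTopologicalGroup (Y ≃ₜ Y) where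
  continuous_mul := by
    refine isInducing_homeoToContinuousMap.continuous_iff.2 ?_
    exact ContinuousMap.continuous_comp'.comp
      ((continuous_homeoToContinuousMap.comp continuous_snd).prodMk
        (continuous_homeoToContinuousMap.comp continuous_fst))
  continuous_inv := by
    refine isInducing_homeoToContinuousMap.continuous_iff.2 ?_
    refine ContinuousMap.continuous_compactOpen.2 fun K hK U hU => ?_
    -- f⁻¹ maps K into U exactly when f maps the complement of U into the complement of K, and by
    -- compactness this is again a subbasic open condition.
    have h1 : {f : Y ≃ₜ Y | Set.MapsTo (homeoToContinuousMap f⁻¹) K U} =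
        homeoToContinuousMap ⁻¹' {f : C(Y, Y) | Set.MapsTo f Uᶜ Kᶜ} := by
      ext f
      constructor
      · intro h y hy hK'
        have := h hK'
        exact hy (by simpa [homeoToContinuousMap] using this)
      · intro h y hy
        by_contra hU'
        exact h hU' (by simpa [homeoToContinuousMap] using hy)
    change IsOpen {f : Y ≃ₜ Y | Set.MapsTo (homeoToContinuousMap f⁻¹) K U}
    rw [h1]
    exact (ContinuousMap.isOpen_setOfPred_mapsTo hU.isClosed_compl.isCompact
      hK.isClosed.isOpen_compl).preimage continuous_homeoToContinuousMap

instance homeo_secondCountableTopology [CompactSpace Y] [T2Space Y] [SecondCountableTopology Y] :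
    SecondCountableTopology (Y ≃ₜ Y) :=
  isEmbedding_homeoToContinuousMap.secondCountableTopology

/-- Covers limit sets with at most two points: a finite Hausdorff group is discrete, and counting
measure on the quotient is invariant. -/
theorem isLattice_of_finite {G : Type*} [Group G] [TopologicalSpace G] [T2Space G] [Finite G]
    (L : Subgroup G) : IsLattice L where
  isTopologicalGroup := { continuous_mul := continuous_of_discreteTopology
                          continuous_inv := continuous_of_discreteTopology }
  t2Space := inferInstance
  locallyCompactSpace := inferInstance
  discreteTopology := inferInstance
  exists_invariant_measure := by
    borelize (G ⧸ L)
    have hm : ∀ A : Set (G ⧸ L), MeasurableSet A := fun A => by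
      refine IsOpen.measurableSet ?_
      rw [← isQuotientMap_quotient_mk'.isOpen_preimage]
      exact isOpen_discrete _
    refine ⟨Measure.count, ?_, ?_, fun g => ?_⟩
    · exact NeZero.ne _
    · rw [Measure.count_apply (hm _)]
      simp
    · refine Measure.ext fun A hA => ?_
      rw [Measure.map_apply (fun s _ => hm _) hA, Measure.count_apply (hm _),
        Measure.count_apply (hm _)]
      congr 1
      exact Set.encard_preimage_of_bijective (MulAction.bijective g) A

end Homeo

/-! ### Arzelà–Ascoli for Lipschitz maps -/

section LipschitzMaps

variable {Y : Type*} [MetricSpace Y] [CompactSpace Y]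

theorem isCompact_setOf_lipschitzWith (C : NNReal) :
    IsCompact {g : C(Y, Y) | LipschitzWith C g} := by
  refine ArzelaAscoli.isCompact_of_equicontinuous _ ?_ ?_
  · have h : ContinuousMap.toFun '' {g : C(Y, Y) | LipschitzWith C g} =
        {g : Y → Y | LipschitzWith C g} := by
      ext g
      constructor
      · rintro ⟨f, hf, rfl⟩
        exact hf
      · exact fun hg => ⟨⟨g, hg.continuous⟩, hg, rfl⟩
    rw [h]
    refine IsClosed.isCompact ?_
    simp only [LipschitzWith, Set.ofPred_forall]
    refine isClosed_iInter fun x => isClosed_iInter fun y => isClosed_le ?_ ?_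
    · exact (continuous_apply x).edist (continuous_apply y)
    · exact continuous_const
  · refine (LipschitzWith.uniformEquicontinuous _ C ?_).equicontinuous
    exact fun g => g.2

end LipschitzMaps

/-! ### From invariant measures to cross ratios and conformal factors -/

section Moebius

variable {Y : Type*} [MetricSpace Y]

/-- The measure `d ^ (-a) ν × ν` on the pairs of distinct points of a metric space. -/
noncomputable def offDiagMeasure [MeasurableSpace Y] (ν : Measure Y) (a : ℝ) : Measure (Y × Y) :=
  ((ν.prod ν).restrict {z | z.1 ≠ z.2}).withDensity
    fun z => ENNReal.ofReal (dist z.1 z.2 ^ (-a))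

theorem measurableSet_offDiag [MeasurableSpace Y] [BorelSpace Y] [SecondCountableTopology Y] :
    MeasurableSet {z : Y × Y | z.1 ≠ z.2} :=
  (isOpen_ne_fun continuous_fst continuous_snd).measurableSet

theorem measurable_ofReal_dist_rpow [MeasurableSpace Y] [BorelSpace Y] [SecondCountableTopology Y]
    (a : ℝ) : Measurable fun z : Y × Y => ENNReal.ofReal (dist z.1 z.2 ^ a) :=
  ((measurable_fst.dist measurable_snd).pow_const a).ennreal_ofReal

instance [MeasurableSpace Y] (ν : Measure Y) [SFinite ν] (a : ℝ) : SFinite (offDiagMeasure ν a) := by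
  unfold offDiagMeasure; infer_instance

/-- The density is continuous off the diagonal, hence nearly constant on S × T. Arbitrary shrinking
sets are allowed, not only balls, so that the limit also applies to the images of balls under a
homeomorphism. -/
theorem tendsto_offDiagMeasure_prod_div [MeasurableSpace Y] [BorelSpace Y]
    [SecondCountableTopology Y] {ν : Measure Y} [IsFiniteMeasure ν] (a : ℝ) {x y : Y} (hxy : x ≠ y)
    {l : Filter ℝ} {S T : ℝ → Set Y} (hS : Tendsto S l (𝓝 x).smallSets)
    (hT : Tendsto T l (𝓝 y).smallSets) (hSm : ∀ i, MeasurableSet (S i))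
    (hTm : ∀ i, MeasurableSet (T i)) (hS0 : ∀ᶠ i in l, ν (S i) ≠ 0)
    (hT0 : ∀ᶠ i in l, ν (T i) ≠ 0) :
    Tendsto (fun i => (offDiagMeasure ν a (S i ×ˢ T i)).toReal / ((ν (S i)).toReal * (ν (T i)).toReal))
      l (𝓝 (dist x y ^ (-a))) := by
  have hcont : ContinuousAt (fun z : Y × Y => dist z.1 z.2 ^ (-a)) (x, y) :=
    (continuous_fst.dist continuous_snd).continuousAt.rpow_const (Or.inl (dist_ne_zero.2 hxy))
  refine Metric.tendsto_nhds.2 fun e he => ?_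
  have hopen : IsOpen {z : Y × Y | z.1 ≠ z.2} := isOpen_ne_fun continuous_fst continuous_snd
  have hU : ∀ᶠ z in 𝓝 (x, y), z.1 ≠ z.2 ∧ |dist z.1 z.2 ^ (-a) - dist x y ^ (-a)| < e / 2 :=
    (hopen.eventually_mem hxy).and (Metric.tendsto_nhds.1 hcont _ (half_pos he))
  rw [nhds_prod_eq] at hU
  obtain ⟨P, hP, Q, hQ, hPQ⟩ := eventually_prod_iff.1 hU
  filter_upwards [(tendsto_smallSets_iff.1 hS) _ hP, (tendsto_smallSets_iff.1 hT) _ hQ, hS0, hT0]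
    with i hSi hTi hS0 hT0
  have hz : ∀ z ∈ S i ×ˢ T i, z.1 ≠ z.2 ∧ |dist z.1 z.2 ^ (-a) - dist x y ^ (-a)| < e / 2 :=
    fun z hz => hPQ (hSi hz.1) (hTi hz.2)
  have hm : offDiagMeasure ν a (S i ×ˢ T i) =
      ∫⁻ z in S i ×ˢ T i, ENNReal.ofReal (dist z.1 z.2 ^ (-a)) ∂(ν.prod ν) := by
    rw [offDiagMeasure, withDensity_apply _ ((hSm i).prod (hTm i)),
      Measure.restrict_restrict ((hSm i).prod (hTm i)),
      Set.inter_eq_left.2 (show S i ×ˢ T i ⊆ {z | z.1 ≠ z.2} from fun z hz' => (hz z hz').1)]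
  have hp : 0 < (ν (S i)).toReal * (ν (T i)).toReal :=
    mul_pos (ENNReal.toReal_pos hS0 (measure_ne_top _ _))
      (ENNReal.toReal_pos hT0 (measure_ne_top _ _))
  have hprod : (ν.prod ν) (S i ×ˢ T i) = ENNReal.ofReal ((ν (S i)).toReal * (ν (T i)).toReal) := by
    rw [Measure.prod_prod, ENNReal.ofReal_mul ENNReal.toReal_nonneg,
      ENNReal.ofReal_toReal (measure_ne_top _ _), ENNReal.ofReal_toReal (measure_ne_top _ _)]
  set V := (ν (S i)).toReal * (ν (T i)).toReal
  set c := dist x y ^ (-a)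
  have hup : offDiagMeasure ν a (S i ×ˢ T i) ≤ ENNReal.ofReal ((c + e / 2) * V) := by
    rw [hm, ENNReal.ofReal_mul' hp.le, ← hprod, ← setLIntegral_const]
    refine setLIntegral_mono measurable_const fun z hz' => ENNReal.ofReal_le_ofReal ?_
    have := abs_lt.1 (hz z hz').2
    linarith
  have hlow : ENNReal.ofReal ((c - e / 2) * V) ≤ offDiagMeasure ν a (S i ×ˢ T i) := by
    rw [hm, ENNReal.ofReal_mul' hp.le, ← hprod, ← setLIntegral_const]
    refine setLIntegral_mono (measurable_ofReal_dist_rpow _) fun z hz' =>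
      ENNReal.ofReal_le_ofReal ?_
    have := abs_lt.1 (hz z hz').2
    linarith
  have hne : offDiagMeasure ν a (S i ×ˢ T i) ≠ ⊤ := ne_top_of_le_ne_top ENNReal.ofReal_ne_top hup
  have hc : 0 ≤ c := by positivity
  have h1 := ENNReal.toReal_mono ENNReal.ofReal_ne_top hup
  rw [ENNReal.toReal_ofReal (by positivity)] at h1
  have h2 := (ENNReal.ofReal_le_iff_le_toReal hne).1 hlow
  rw [Real.dist_eq, abs_lt]
  constructor
  · have : c - e / 2 ≤ (offDiagMeasure ν a (S i ×ˢ T i)).toReal / V := (le_div_iff₀ hp).2 h2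
    linarith
  · have : (offDiagMeasure ν a (S i ×ˢ T i)).toReal / V ≤ c + e / 2 := (div_le_iff₀ hp).2 h1
    linarith

/-- A homeomorphism that preserves `d ^ (-a) ν × ν` preserves cross ratios. -/
theorem crossRatio_eq_of_map_offDiagMeasure [MeasurableSpace Y] [BorelSpace Y]
    [SecondCountableTopology Y] {ν : Measure Y} [IsFiniteMeasure ν] [ν.IsOpenPosMeasure] {a : ℝ}
    (ha : 0 < a) (f : Y ≃ₜ Y)
    (hf : (offDiagMeasure ν a).map (Prod.map f f) = offDiagMeasure ν a) {x y z w : Y}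
    (hxy : x ≠ y) (hxw : x ≠ w) (hzy : z ≠ y) (hzw : z ≠ w) :
    dist (f x) (f y) * dist (f z) (f w) * (dist x w * dist z y) =
      dist x y * dist z w * (dist (f x) (f w) * dist (f z) (f y)) := by
  have hb : ∀ u : Y, Tendsto (fun r => Metric.ball u r) (𝓝[>] (0 : ℝ)) (𝓝 u).smallSets := fun u => by
    refine tendsto_smallSets_iff.2 fun s hs => ?_
    obtain ⟨e, he, hes⟩ := Metric.mem_nhds_iff.1 hs
    filter_upwards [Ioo_mem_nhdsGT he] with r hr
    exact (Metric.ball_subset_ball hr.2.le).trans hes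
  have hb' : ∀ u : Y, Tendsto (fun r => f '' Metric.ball u r) (𝓝[>] (0 : ℝ)) (𝓝 (f u)).smallSets :=
    fun u => by
      refine tendsto_smallSets_iff.2 fun s hs => ?_
      filter_upwards [tendsto_smallSets_iff.1 (hb u) _ (f.continuous.continuousAt hs)] with r hr
      exact Set.image_subset_iff.2 hr
  have h0 : ∀ u : Y, ∀ᶠ r in 𝓝[>] (0 : ℝ), ν (Metric.ball u r) ≠ 0 := fun u => by
    filter_upwards [self_mem_nhdsWithin] with r hr
    exact (Metric.measure_ball_pos ν u hr).ne'
  have h0' : ∀ u : Y, ∀ᶠ r in 𝓝[>] (0 : ℝ), ν (f '' Metric.ball u r) ≠ 0 := fun u => by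
    filter_upwards [self_mem_nhdsWithin] with r hr
    exact ((f.isOpenMap _ Metric.isOpen_ball).measure_pos ν
      ⟨f u, u, Metric.mem_ball_self hr, rfl⟩).ne'
  have hm : ∀ (u : Y) (r : ℝ), MeasurableSet (Metric.ball u r) := fun u r => measurableSet_ball
  have hm' : ∀ (u : Y) (r : ℝ), MeasurableSet (f '' Metric.ball u r) := fun u r =>
    (f.isOpenMap _ Metric.isOpen_ball).measurableSet
  have hinv : ∀ (u v : Y) (r : ℝ), offDiagMeasure ν a ((f '' Metric.ball u r) ×ˢ (f '' Metric.ball v r))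
      = offDiagMeasure ν a (Metric.ball u r ×ˢ Metric.ball v r) := fun u v r => by
    conv_lhs => rw [← hf]
    rw [Measure.map_apply (f.measurable.prodMap f.measurable) ((hm' u r).prod (hm' v r)),
      Set.preimage_prod_map_prod, f.injective.preimage_image, f.injective.preimage_image]
  have hlim := fun {u v : Y} (h : u ≠ v) => tendsto_offDiagMeasure_prod_div (ν := ν) a h (hb u) (hb v)
    (hm u) (hm v) (h0 u) (h0 v)
  have hlim' := fun {u v : Y} (h : u ≠ v) => tendsto_offDiagMeasure_prod_div (ν := ν) a
    (f.injective.ne h) (hb' u) (hb' v) (hm' u) (hm' v) (h0' u) (h0' v)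
  -- The two products have equal terms: the pair measures agree by invariance, and each of the eight
  -- ν-masses (of the four balls and their images) occurs once in either denominator.
  have hL := ((hlim' hxy).mul (hlim' hzw)).mul ((hlim hxw).mul (hlim hzy))
  have hR := ((hlim hxy).mul (hlim hzw)).mul ((hlim' hxw).mul (hlim' hzy))
  have key := tendsto_nhds_unique (hL.congr' ?_) hR
  · rw [← Real.mul_rpow, ← Real.mul_rpow, ← Real.mul_rpow, ← Real.mul_rpow, ← Real.mul_rpow,
      ← Real.mul_rpow] at key
    · refine (Real.rpow_left_inj (x := _) (y := _) (z := -a) ?_ ?_ ?_).1 key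
      · positivity
      · positivity
      · linarith
    all_goals positivity
  · filter_upwards [h0 x, h0 y, h0 z, h0 w, h0' x, h0' y, h0' z, h0' w]
      with r hx hy hz hw hx' hy' hz' hw'
    simp only [hinv]
    have hp : ∀ s : Set Y, ν s ≠ 0 → (ν s).toReal ≠ 0 := fun s hs =>
      (ENNReal.toReal_pos hs (measure_ne_top _ _)).ne'
    have := hp _ hx
    have := hp _ hy
    have := hp _ hz
    have := hp _ hw
    have := hp _ hx'
    have := hp _ hy'
    have := hp _ hz'
    have := hp _ hw'
    field_simp

/-- `φ` is the conformal factor of `f`: `d(fx, fy)² = φ(x) φ(y) d(x, y)²`. -/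
def IsConformalFactor (f : Y → Y) (φ : Y → ℝ) : Prop :=
  (∀ x, 0 < φ x) ∧ ∀ x y, dist (f x) (f y) ^ 2 = φ x * φ y * dist x y ^ 2

theorem IsConformalFactor.comp {f g : Y → Y} {φ ψ : Y → ℝ} (hf : IsConformalFactor f φ)
    (hg : IsConformalFactor g ψ) : IsConformalFactor (f ∘ g) fun x => φ (g x) * ψ x :=
  ⟨fun x => mul_pos (hf.1 _) (hg.1 _), fun x y => by
    simp only [Function.comp, hf.2, hg.2]; ring⟩

theorem IsConformalFactor.symm {f : Y ≃ₜ Y} {φ : Y → ℝ} (hf : IsConformalFactor f φ) :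
    IsConformalFactor f.symm fun x => (φ (f.symm x))⁻¹ :=
  ⟨fun x => inv_pos.2 (hf.1 _), fun x y => by
    have h := hf.2 (f.symm x) (f.symm y)
    have h1 := (hf.1 (f.symm x)).ne'
    have h2 := (hf.1 (f.symm y)).ne'
    simp only [Homeomorph.apply_symm_apply] at h
    rw [h]
    field_simp⟩

/-- Multiplying the relations for (x,y) and (x,z) and dividing by that for (y,z) isolates φ(x)².
This gives uniqueness, continuity and the lower bounds for conformal factors. -/
theorem IsConformalFactor.eq_div {f : Y → Y} {φ : Y → ℝ} (hf : IsConformalFactor f φ)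
    {x y z : Y} (hxy : x ≠ y) (hxz : x ≠ z) (hyz : y ≠ z) :
    φ x = dist (f x) (f y) * dist (f x) (f z) * dist y z /
      (dist x y * dist x z * dist (f y) (f z)) := by
  have h1 := hf.2 x y
  have h2 := hf.2 x z
  have h3 := hf.2 y z
  have p1 := dist_pos.2 hxy
  have p2 := dist_pos.2 hxz
  have p3 := dist_pos.2 hyz
  have q1 := hf.1 x
  have q2 := hf.1 y
  have q3 := hf.1 z
  have hne : dist (f y) (f z) ≠ 0 := by
    intro h
    rw [h] at h3
    have : 0 < φ y * φ z * dist y z ^ 2 := by positivity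
    linarith
  have p4 : 0 < dist (f y) (f z) := lt_of_le_of_ne dist_nonneg hne.symm
  rw [eq_div_iff (by positivity)]
  refine (sq_eq_sq₀ (by positivity) (by positivity)).1 ?_
  simp only [mul_pow, h1, h2, h3]
  ring

theorem IsConformalFactor.unique (h3 : ∀ x : Y, ∃ y z : Y, x ≠ y ∧ x ≠ z ∧ y ≠ z) {f : Y → Y}
    {φ ψ : Y → ℝ} (hφ : IsConformalFactor f φ) (hψ : IsConformalFactor f ψ) : φ = ψ := by
  funext x
  obtain ⟨y, z, hxy, hxz, hyz⟩ := h3 x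
  rw [hφ.eq_div hxy hxz hyz, hψ.eq_div hxy hxz hyz]

/-- With D(x,y) = d(fx,fy)/d(x,y), invariance of cross ratios says that D(x,y)D(z,w) = D(x,w)D(z,y).
The values φ(a) = t and φ(x) = D(a,x)²/t are dictated by a base triple a, b, c. -/
theorem exists_isConformalFactor_of_crossRatio (h3 : ∀ x : Y, ∃ y z : Y, x ≠ y ∧ x ≠ z ∧ y ≠ z)
    {f : Y → Y} (hinj : Function.Injective f)
    (hf : ∀ {x y z w : Y}, x ≠ y → x ≠ w → z ≠ y → z ≠ w →
      dist (f x) (f y) * dist (f z) (f w) * (dist x w * dist z y) =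
        dist x y * dist z w * (dist (f x) (f w) * dist (f z) (f y))) :
    ∃ φ, IsConformalFactor f φ := by
  classical
  rcases isEmpty_or_nonempty Y with hY | ⟨⟨a⟩⟩
  · exact ⟨fun _ => 1, fun x => hY.elim x, fun x => hY.elim x⟩
  obtain ⟨b, c, hab, hac, hbc⟩ := h3 a
  let D : Y → Y → ℝ := fun x y => dist (f x) (f y) / dist x y
  have hD0 : ∀ {x y}, x ≠ y → 0 < D x y := fun h =>
    div_pos (dist_pos.2 (hinj.ne h)) (dist_pos.2 h)
  have hDs : ∀ x y, D x y = D y x := fun x y => by simp only [D, dist_comm]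
  have hD : ∀ {x y z w : Y}, x ≠ y → x ≠ w → z ≠ y → z ≠ w → D x y * D z w = D x w * D z y := by
    intro x y z w h1 h2 h3 h4
    have := hf h1 h2 h3 h4
    have p1 := dist_pos.2 h1
    have p2 := dist_pos.2 h2
    have p3 := dist_pos.2 h3
    have p4 := dist_pos.2 h4
    simp only [D]
    field_simp
    linarith
  have hDd : ∀ x y, dist (f x) (f y) = D x y * dist x y := by
    intro x y
    by_cases h : x = y
    · simp [h]
    · have := dist_pos.2 h
      simp only [D]
      field_simp
  have key : ∀ {x y}, x ≠ y → a ≠ x → a ≠ y → D a x * D a y * D b c = D a b * D a c * D x y := by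
    intro x y hxy hax hay
    -- The general case passes through the pair y, b, which degenerates when y = b; one exchange
    -- then suffices.
    by_cases hyb : y = b
    · subst hyb
      have h1 := hD hax hac hxy.symm hbc
      rw [hDs y x] at h1
      linear_combination D a y * h1
    · have h1 := hD hay hac (Ne.symm hyb) hbc
      have h2 := hD hax hab hxy.symm hyb
      rw [hDs y b, hDs y x] at h2
      linear_combination D a x * h1 + D a c * h2
  set t := D a b * D a c / D b c with ht
  have ht0 : 0 < t := div_pos (mul_pos (hD0 hab) (hD0 hac)) (hD0 hbc)
  refine ⟨fun x => if x = a then t else D a x ^ 2 / t, fun x => ?_, fun x y => ?_⟩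
  · dsimp only
    split_ifs with h
    · exact ht0
    · have := hD0 (Ne.symm h)
      positivity
  · dsimp only
    rw [hDd]
    by_cases hxy : x = y
    · simp [hxy]
    by_cases hx : x = a
    · have hy : y ≠ a := fun h => hxy (hx.trans h.symm)
      rw [if_pos hx, if_neg hy, hx]
      field_simp
    by_cases hy : y = a
    · rw [if_neg hx, if_pos hy, hy, hDs x a]
      field_simp
    rw [if_neg hx, if_neg hy]
    have h1 := key hxy (Ne.symm hx) (Ne.symm hy)
    have h2 : D a x * D a y = t * D x y := by
      have := (hD0 hbc).ne'
      rw [ht]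
      field_simp
      linarith
    have h3 : D a x ^ 2 / t * (D a y ^ 2 / t) = D x y ^ 2 := by
      have : D a x ^ 2 / t * (D a y ^ 2 / t) = (D a x * D a y) ^ 2 / t ^ 2 := by
        field_simp
      rw [this, h2]
      field_simp
    rw [h3]
    ring

theorem IsConformalFactor.lipschitzWith {f : Y → Y} {φ : Y → ℝ} (hf : IsConformalFactor f φ)
    {C : NNReal} (hC : ∀ x, φ x ≤ C) : LipschitzWith C f := by
  refine LipschitzWith.of_dist_le_mul fun x y => ?_
  refine (sq_le_sq₀ dist_nonneg (by positivity)).1 ?_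
  rw [hf.2, mul_pow]
  refine mul_le_mul_of_nonneg_right ?_ (sq_nonneg _)
  rw [sq]
  exact mul_le_mul (hC x) (hC y) (hf.1 y).le C.2

/-- Every z is at distance at least r/2 from one of x and y, say u, and then φ(u)φ(z)(r/2)² ≤
d(fu,fz)² ≤ 1. -/
theorem IsConformalFactor.le_of_le {f : Y → Y} {φ : Y → ℝ} (hf : IsConformalFactor f φ)
    (hdiam : ∀ x y : Y, dist x y ≤ 1) {x y : Y} {r c : ℝ} (hr : 0 < r) (hc : 0 < c)
    (hxy : r ≤ dist x y) (hx : c ≤ φ x) (hy : c ≤ φ y) (z : Y) : φ z ≤ 4 / (c * r ^ 2) := by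
  have main : ∀ u, c ≤ φ u → r / 2 ≤ dist u z → φ z ≤ 4 / (c * r ^ 2) := by
    intro u hu huz
    have h1 := hf.2 u z
    have h2 : dist (f u) (f z) ^ 2 ≤ 1 := pow_le_one₀ dist_nonneg (hdiam _ _)
    have h3 : (r / 2) ^ 2 ≤ dist u z ^ 2 := pow_le_pow_left₀ (by positivity) huz 2
    have hz := hf.1 z
    have hu' := hf.1 u
    have h4 : c * φ z * (r / 2) ^ 2 ≤ φ u * φ z * dist u z ^ 2 := by
      gcongr
    rw [le_div_iff₀ (by positivity)]
    nlinarith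
  by_cases h : r / 2 ≤ dist x z
  · exact main x hx h
  · refine main y hy ?_
    have := dist_triangle x z y
    rw [dist_comm z y] at this
    push Not at h
    linarith

theorem IsConformalFactor.ge_of_separated {f : Y → Y} {φ : Y → ℝ} (hf : IsConformalFactor f φ)
    (hdiam : ∀ x y : Y, dist x y ≤ 1) {x y z : Y} {s : ℝ} (hs : 0 < s)
    (hxy : x ≠ y) (hxz : x ≠ z) (hyz : s ≤ dist y z)
    (hfxy : s ≤ dist (f x) (f y)) (hfxz : s ≤ dist (f x) (f z)) : s ^ 3 ≤ φ x := by
  have h := hf.eq_div hxy hxz (dist_pos.1 (hs.trans_le hyz))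
  have p1 := dist_pos.2 hxy
  have p2 := dist_pos.2 hxz
  have p3 : 0 < dist (f y) (f z) := by
    refine lt_of_le_of_ne dist_nonneg fun h0 => ?_
    rw [← h0, mul_zero, div_zero] at h
    exact (hf.1 x).ne' h
  rw [h, le_div_iff₀ (by positivity)]
  have h1 : dist x y * dist x z * dist (f y) (f z) ≤ 1 := by
    refine mul_le_one₀ (mul_le_one₀ (hdiam _ _) dist_nonneg (hdiam _ _)) dist_nonneg (hdiam _ _)
  have h2 : s * s * s ≤ dist (f x) (f y) * dist (f x) (f z) * dist y z := by gcongr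
  nlinarith [pow_pos hs 3]

end Moebius

/-! ### Compactness of the bi-Lipschitz parts of the group -/

section LipschitzPart

variable {Y : Type*} [MetricSpace Y] [CompactSpace Y] [MeasurableSpace Y] [BorelSpace Y]

/-- The integral of `u d ^ a` with respect to the image of `d ^ (-a) ν × ν` under `g × g`. -/
noncomputable def weightedIntegral (ν : Measure Y) (a : ℝ) (u : BoundedContinuousFunction (Y × Y) NNReal)
    (g : Y → Y) : ℝ≥0∞ :=
  ∫⁻ z in {z : Y × Y | z.1 ≠ z.2},
    ENNReal.ofReal (dist z.1 z.2 ^ (-a)) *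
      (u (g z.1, g z.2) * ENNReal.ofReal (dist (g z.1) (g z.2) ^ a)) ∂(ν.prod ν)

theorem measurable_weight (a : ℝ) (u : BoundedContinuousFunction (Y × Y) NNReal) :
    Measurable fun z : Y × Y => (u z : ℝ≥0∞) * ENNReal.ofReal (dist z.1 z.2 ^ a) :=
  (u.continuous.measurable.coe_nnreal_ennreal).mul (measurable_ofReal_dist_rpow a)

theorem lintegral_map_offDiagMeasure (ν : Measure Y) (a : ℝ)
    (u : BoundedContinuousFunction (Y × Y) NNReal) {g : Y → Y} (hg : Measurable g) :
    ∫⁻ z, u z ∂(((offDiagMeasure ν a).map (Prod.map g g)).withDensity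
      fun z => ENNReal.ofReal (dist z.1 z.2 ^ a)) = weightedIntegral ν a u g := by
  rw [lintegral_withDensity_eq_lintegral_mul _ (measurable_ofReal_dist_rpow a)
    u.continuous.measurable.coe_nnreal_ennreal, lintegral_map
      ((measurable_ofReal_dist_rpow a).mul u.continuous.measurable.coe_nnreal_ennreal)
      (hg.prodMap hg), offDiagMeasure]
  refine (lintegral_withDensity_eq_lintegral_mul _ (measurable_ofReal_dist_rpow (-a))
    (((measurable_ofReal_dist_rpow a).mul u.continuous.measurable.coe_nnreal_ennreal).comp
    (hg.prodMap hg))).trans ?_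
  refine lintegral_congr fun z => ?_
  simp only [Pi.mul_apply]
  exact congrArg (ENNReal.ofReal (dist z.1 z.2 ^ (-a)) * ·)
    (mul_comm (ENNReal.ofReal (dist (g z.1) (g z.2) ^ a)) (u (g z.1, g z.2) : ℝ≥0∞))

theorem weight_le {Y : Type*} [MetricSpace Y] {a : ℝ} (ha : 0 < a) {C : NNReal} {g : Y → Y} (hg : LipschitzWith C g)
    (u : BoundedContinuousFunction (Y × Y) NNReal) {z : Y × Y} (hz : z.1 ≠ z.2) :
    ENNReal.ofReal (dist z.1 z.2 ^ (-a)) *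
      (u (g z.1, g z.2) * ENNReal.ofReal (dist (g z.1) (g z.2) ^ a)) ≤
      (nndist u 0 : ℝ≥0∞) * ENNReal.ofReal ((C : ℝ) ^ a) := by
  have h1 : (u (g z.1, g z.2) : ℝ≥0∞) ≤ nndist u 0 := by
    have := u.nndist_coe_le_nndist (g := 0) (g z.1, g z.2)
    rw [BoundedContinuousFunction.coe_zero, Pi.zero_apply, NNReal.nndist_zero_eq_val'] at this
    exact_mod_cast this
  have h2 : ENNReal.ofReal (dist z.1 z.2 ^ (-a)) * ENNReal.ofReal (dist (g z.1) (g z.2) ^ a) ≤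
      ENNReal.ofReal ((C : ℝ) ^ a) := by
    rw [← ENNReal.ofReal_mul (by positivity)]
    refine ENNReal.ofReal_le_ofReal ?_
    have hd := dist_pos.2 hz
    have h3 : dist (g z.1) (g z.2) ^ a ≤ (C * dist z.1 z.2) ^ a :=
      Real.rpow_le_rpow dist_nonneg (hg.dist_le_mul _ _) ha.le
    rw [Real.mul_rpow C.coe_nonneg hd.le] at h3
    calc dist z.1 z.2 ^ (-a) * dist (g z.1) (g z.2) ^ a
        ≤ dist z.1 z.2 ^ (-a) * ((C : ℝ) ^ a * dist z.1 z.2 ^ a) := by gcongr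
      _ = (C : ℝ) ^ a * (dist z.1 z.2 ^ (-a) * dist z.1 z.2 ^ a) := by ring
      _ = (C : ℝ) ^ a := by rw [← Real.rpow_add hd]; simp
  calc _ = (u (g z.1, g z.2) : ℝ≥0∞) * (ENNReal.ofReal (dist z.1 z.2 ^ (-a)) *
        ENNReal.ofReal (dist (g z.1) (g z.2) ^ a)) := by ring
    _ ≤ _ := mul_le_mul' h1 h2

theorem weightedIntegral_lt_top {Y : Type*} [MetricSpace Y] [MeasurableSpace Y] (ν : Measure Y) [IsFiniteMeasure ν] {a : ℝ} (ha : 0 < a)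
    {C : NNReal} {g : Y → Y} (hg : LipschitzWith C g)
    (u : BoundedContinuousFunction (Y × Y) NNReal) : weightedIntegral ν a u g < ⊤ := by
  have h : weightedIntegral ν a u g ≤ ∫⁻ _ in {z : Y × Y | z.1 ≠ z.2},
      (nndist u 0 : ℝ≥0∞) * ENNReal.ofReal ((C : ℝ) ^ a) ∂(ν.prod ν) :=
    setLIntegral_mono measurable_const fun z hz => weight_le ha hg u hz
  refine h.trans_lt ?_
  rw [setLIntegral_const]
  exact ENNReal.mul_lt_top (ENNReal.mul_lt_top ENNReal.coe_lt_top ENNReal.ofReal_lt_top)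
    (measure_lt_top _ _)

theorem offDiagMeasure_ae_ne (ν : Measure Y) (a : ℝ) : ∀ᵐ z ∂(offDiagMeasure ν a), z.1 ≠ z.2 :=
  (withDensity_absolutelyContinuous _ _).ae_le (ae_restrict_mem measurableSet_offDiag)

/-- The measure d^(-a) ν × ν may be infinite near the diagonal, so it cannot be tested directly on
bounded continuous functions. Multiplying by d^a makes it and its image under the Lipschitz map f ×
f finite; as d^a is positive off the diagonal, nothing is lost. In this form invariance passes to
limits of C-Lipschitz maps. -/
theorem map_offDiagMeasure_eq_iff (ν : Measure Y) [IsFiniteMeasure ν] {a : ℝ} (ha : 0 < a)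
    {C : NNReal} (f : Y ≃ₜ Y) (hf : LipschitzWith C f) :
    (offDiagMeasure ν a).map (Prod.map f f) = offDiagMeasure ν a ↔
      ∀ u, weightedIntegral ν a u f = weightedIntegral ν a u id := by
  have hid : (offDiagMeasure ν a).map (Prod.map id id) = offDiagMeasure ν a := by
    rw [Prod.map_id, Measure.map_id]
  constructor
  · intro h u
    rw [← lintegral_map_offDiagMeasure ν a u f.measurable,
      ← lintegral_map_offDiagMeasure ν a u measurable_id, h, hid]
  · intro h
    set w : Y × Y → ℝ≥0∞ := fun z => ENNReal.ofReal (dist z.1 z.2 ^ a)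
    have hw : Measurable w := measurable_ofReal_dist_rpow a
    have hwpos : ∀ z : Y × Y, z.1 ≠ z.2 → w z ≠ 0 := fun z hz => by
      have := dist_pos.2 hz
      simp only [w, ne_eq, ENNReal.ofReal_eq_zero, not_le]
      positivity
    have hfin : ∀ (g : Y → Y) (K : NNReal), LipschitzWith K g →
        IsFiniteMeasure (((offDiagMeasure ν a).map (Prod.map g g)).withDensity w) := by
      intro g K hg
      refine ⟨?_⟩
      have h1 := lintegral_map_offDiagMeasure ν a 1 hg.continuous.measurable
      simp only [BoundedContinuousFunction.coe_one, Pi.one_apply, ENNReal.coe_one,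
        lintegral_one] at h1
      rw [h1]
      exact weightedIntegral_lt_top ν ha hg 1
    have h1 := hfin f C hf
    have h2 := hfin id 1 LipschitzWith.id
    rw [hid] at h2
    have h3 : ((offDiagMeasure ν a).map (Prod.map f f)).withDensity w =
        (offDiagMeasure ν a).withDensity w := by
      refine ext_of_forall_lintegral_eq_of_IsFiniteMeasure fun u => ?_
      have := h u
      rw [← lintegral_map_offDiagMeasure ν a u f.measurable,
        ← lintegral_map_offDiagMeasure ν a u measurable_id, hid] at this
      exact this
    have h4 : ∀ᵐ z ∂((offDiagMeasure ν a).map (Prod.map f f)), z.1 ≠ z.2 := by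
      refine (ae_map_iff (f.measurable.prodMap f.measurable).aemeasurable
        measurableSet_offDiag).2 ?_
      filter_upwards [offDiagMeasure_ae_ne ν a] with z hz
      exact f.injective.ne hz
    rw [← withDensity_inv_same hw (h4.mono hwpos) (ae_of_all _ fun z => ENNReal.ofReal_ne_top),
      h3, withDensity_inv_same hw ((offDiagMeasure_ae_ne ν a).mono hwpos)
      (ae_of_all _ fun z => ENNReal.ofReal_ne_top)]

theorem tendsto_weightedIntegral (ν : Measure Y) [IsFiniteMeasure ν] {a : ℝ} (ha : 0 < a)
    {C : NNReal} (u : BoundedContinuousFunction (Y × Y) NNReal) {g : ℕ → Y → Y} {g₀ : Y → Y}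
    (hg : ∀ n, LipschitzWith C (g n)) (h : ∀ y, Tendsto (fun n => g n y) atTop (𝓝 (g₀ y))) :
    Tendsto (fun n => weightedIntegral ν a u (g n)) atTop (𝓝 (weightedIntegral ν a u g₀)) := by
  refine tendsto_lintegral_of_dominated_convergence
    (fun _ => (nndist u 0 : ℝ≥0∞) * ENNReal.ofReal ((C : ℝ) ^ a)) (fun n => ?_) (fun n => ?_) ?_ ?_
  · exact (measurable_ofReal_dist_rpow (-a)).mul ((measurable_weight a u).comp
      ((hg n).continuous.measurable.prodMap (hg n).continuous.measurable))
  · filter_upwards [ae_restrict_mem measurableSet_offDiag] with z hz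
    exact weight_le ha (hg n) u hz
  · rw [lintegral_const]
    exact (ENNReal.mul_lt_top (ENNReal.mul_lt_top ENNReal.coe_lt_top ENNReal.ofReal_lt_top)
      (measure_lt_top _ _)).ne
  · refine ae_of_all _ fun z => ?_
    have h1 := (h z.1).prodMk_nhds (h z.2)
    refine ENNReal.Tendsto.const_mul ?_ (Or.inr ENNReal.ofReal_ne_top)
    refine ENNReal.Tendsto.mul ?_ (Or.inr ENNReal.ofReal_ne_top) ?_ (Or.inr ENNReal.coe_ne_top)
    · exact ENNReal.tendsto_coe.2 ((u.continuous.tendsto _).comp h1)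
    · exact ENNReal.tendsto_ofReal (((h z.1).dist (h z.2)).rpow_const (Or.inr ha.le))

/-- The elements of a group of homeomorphisms that are `C`-Lipschitz along with their inverses. -/
def lipschitzPart (H : Subgroup (Y ≃ₜ Y)) (C : NNReal) : Set H :=
  {h | LipschitzWith C h.1 ∧ LipschitzWith C (h⁻¹).1}

theorem isCompact_lipschitzPart (ν : Measure Y) [IsFiniteMeasure ν] {a : ℝ} (ha : 0 < a)
    {H : Subgroup (Y ≃ₜ Y)}
    (hH : ∀ f, f ∈ H ↔ (offDiagMeasure ν a).map (Prod.map f f) = offDiagMeasure ν a) (C : NNReal) :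
    IsCompact (lipschitzPart H C) := by
  -- Carrying the inverse along as a second coordinate ensures that a limit of homeomorphisms is
  -- again a homeomorphism. The first projection of E is the set in question.
  let E : Set (C(Y, Y) × C(Y, Y)) := {q | LipschitzWith C q.1 ∧ LipschitzWith C q.2 ∧
    (∀ y, q.1 (q.2 y) = y) ∧ (∀ y, q.2 (q.1 y) = y) ∧
    ∀ u, weightedIntegral ν a u q.1 = weightedIntegral ν a u id}
  have hev : ∀ {q : ℕ → C(Y, Y)} {q₀ : C(Y, Y)}, Tendsto q atTop (𝓝 q₀) →
      ∀ {y : ℕ → Y} {y₀ : Y}, Tendsto y atTop (𝓝 y₀) →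
      Tendsto (fun n => q n (y n)) atTop (𝓝 (q₀ y₀)) := by
    intro q q₀ hq y y₀ hy
    exact ((continuous_eval (F := C(Y, Y))).tendsto (q₀, y₀)).comp (hq.prodMk_nhds hy)
  have hE : IsCompact E := by
    have hLip := isCompact_setOf_lipschitzWith (Y := Y) C
    refine (hLip.prod hLip).of_isClosed_subset ?_ fun q hq => ⟨hq.1, hq.2.1⟩
    refine IsSeqClosed.isClosed fun q q₀ hq hq₀ => ?_
    have h1 : Tendsto (fun n => (q n).1) atTop (𝓝 q₀.1) := (continuous_fst.tendsto _).comp hq₀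
    have h2 : Tendsto (fun n => (q n).2) atTop (𝓝 q₀.2) := (continuous_snd.tendsto _).comp hq₀
    refine ⟨hLip.isClosed.mem_of_tendsto h1 (Eventually.of_forall fun n => (hq n).1),
      hLip.isClosed.mem_of_tendsto h2 (Eventually.of_forall fun n => (hq n).2.1),
      fun y => ?_, fun y => ?_, fun u => ?_⟩
    · refine tendsto_nhds_unique (hev h1 (hev h2 (tendsto_const_nhds (x := y)))) ?_
      simp only [(hq _).2.2.1, tendsto_const_nhds]
    · refine tendsto_nhds_unique (hev h2 (hev h1 (tendsto_const_nhds (x := y)))) ?_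
      simp only [(hq _).2.2.2.1, tendsto_const_nhds]
    · refine tendsto_nhds_unique (tendsto_weightedIntegral ν ha u (g := fun n => (q n).1)
        (fun n => (hq n).1) fun y => hev h1 tendsto_const_nhds) ?_
      simp only [(hq _).2.2.2.2 u, tendsto_const_nhds]
  have hind : IsInducing fun h : H => homeoToContinuousMap h.1 :=
    isInducing_homeoToContinuousMap.comp IsInducing.subtypeVal
  rw [hind.isCompact_iff]
  convert hE.image continuous_fst
  ext g
  constructor
  · rintro ⟨h, ⟨h1, h2⟩, rfl⟩
    refine ⟨(homeoToContinuousMap h.1, homeoToContinuousMap (h⁻¹).1), ⟨h1, h2, fun y => ?_,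
      fun y => ?_, ?_⟩, rfl⟩
    · exact h.1.apply_symm_apply y
    · exact h.1.symm_apply_apply y
    · exact (map_offDiagMeasure_eq_iff ν ha h.1 h1).1 ((hH _).1 h.2)
  · rintro ⟨q, ⟨h1, h2, h3, h4, h5⟩, rfl⟩
    let f : Y ≃ₜ Y :=
      { toFun := q.1, invFun := q.2, left_inv := h4, right_inv := h3
        continuous_toFun := q.1.continuous, continuous_invFun := q.2.continuous }
    have hf : f ∈ H := (hH f).2 ((map_offDiagMeasure_eq_iff ν ha f h1).2 h5)
    exact ⟨⟨f, hf⟩, ⟨h1, h2⟩, rfl⟩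

end LipschitzPart

/-! ### The lifted action on pairs of points times the line -/

section ConformalFactor

variable {Y : Type*} [MetricSpace Y]

open Classical in
/-- The conformal factor of `f`, where it exists. -/
noncomputable def conformalFactor (f : Y → Y) : Y → ℝ :=
  if h : ∃ φ, IsConformalFactor f φ then h.choose else 1

theorem isConformalFactor_conformalFactor {f : Y → Y} (h : ∃ φ, IsConformalFactor f φ) :
    IsConformalFactor f (conformalFactor f) := by
  rw [conformalFactor, dif_pos h]
  exact h.choose_spec

theorem IsConformalFactor.conformalFactor_eq (h3 : ∀ x : Y, ∃ y z : Y, x ≠ y ∧ x ≠ z ∧ y ≠ z)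
    {f : Y → Y} {φ : Y → ℝ} (h : IsConformalFactor f φ) : conformalFactor f = φ :=
  (isConformalFactor_conformalFactor ⟨φ, h⟩).unique h3 h

/-- The lift of `f` to pairs of points times `ℝ`, `(x, y, s) ↦ (fx, fy, s + log (φ(x) / φ(y)) / κ)`
where `φ` is the conformal factor of `f`. -/
noncomputable def flowLift (κ : ℝ) (f : Y → Y) (z : (Y × Y) × ℝ) : (Y × Y) × ℝ :=
  (Prod.map f f z.1,
    z.2 + (Real.log (conformalFactor f z.1.1) - Real.log (conformalFactor f z.1.2)) / κ)

theorem flowLift_comp (h3 : ∀ x : Y, ∃ y z : Y, x ≠ y ∧ x ≠ z ∧ y ≠ z) (κ : ℝ) {f g : Y → Y}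
    (hf : ∃ φ, IsConformalFactor f φ) (hg : ∃ φ, IsConformalFactor g φ) (z : (Y × Y) × ℝ) :
    flowLift κ (f ∘ g) z = flowLift κ f (flowLift κ g z) := by
  have hf' := isConformalFactor_conformalFactor hf
  have hg' := isConformalFactor_conformalFactor hg
  have h := (hf'.comp hg').conformalFactor_eq h3
  refine Prod.ext rfl ?_
  simp only [flowLift, h, Prod.map]
  rw [Real.log_mul (hf'.1 _).ne' (hg'.1 _).ne', Real.log_mul (hf'.1 _).ne' (hg'.1 _).ne']
  ring

theorem flowLift_id (h3 : ∀ x : Y, ∃ y z : Y, x ≠ y ∧ x ≠ z ∧ y ≠ z) (κ : ℝ) (z : (Y × Y) × ℝ) :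
    flowLift κ id z = z := by
  have h : IsConformalFactor (id : Y → Y) fun _ => 1 :=
    ⟨fun _ => one_pos, fun x y => by simp⟩
  simp [flowLift, h.conformalFactor_eq h3]

/-- Separation of the image pair bounds log φ(x) + log φ(y) below by 2 log r at the two points of z,
and the time coordinate bounds the difference of the logarithms by 2κ. So φ ≥ r exp(-κ) at both
points, and `IsConformalFactor.le_of_le` applies. -/
theorem le_conformalFactor_of_flowLift (hdiam : ∀ x y : Y, dist x y ≤ 1) {κ : ℝ} (hκ : 0 < κ)
    {f : Y → Y} (hf : ∃ φ, IsConformalFactor f φ) {r : ℝ} (hr : 0 < r) {z : (Y × Y) × ℝ}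
    (hz : r ≤ dist z.1.1 z.1.2) (hz' : |z.2| ≤ 1)
    (hfz : r ≤ dist (f z.1.1) (f z.1.2)) (hfz' : |(flowLift κ f z).2| ≤ 1) (x : Y) :
    conformalFactor f x ≤ 4 / (r * Real.exp (-κ) * r ^ 2) := by
  have h := isConformalFactor_conformalFactor hf
  set φ := conformalFactor f with hφ
  have h1 := h.2 z.1.1 z.1.2
  have p1 := h.1 z.1.1
  have p2 := h.1 z.1.2
  have h2 : r ^ 2 ≤ φ z.1.1 * φ z.1.2 := by
    have h3 : dist z.1.1 z.1.2 ^ 2 ≤ 1 := pow_le_one₀ dist_nonneg (hdiam _ _)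
    have h4 : r ^ 2 ≤ dist (f z.1.1) (f z.1.2) ^ 2 := pow_le_pow_left₀ hr.le hfz 2
    have h5 : φ z.1.1 * φ z.1.2 * dist z.1.1 z.1.2 ^ 2 ≤ φ z.1.1 * φ z.1.2 * 1 := by gcongr
    linarith
  have h3 : 2 * Real.log r ≤ Real.log (φ z.1.1) + Real.log (φ z.1.2) := by
    rw [← Real.log_mul p1.ne' p2.ne']
    have := Real.log_le_log (by positivity) h2
    rwa [Real.log_pow] at this
  have h4 : |Real.log (φ z.1.1) - Real.log (φ z.1.2)| ≤ 2 * κ := by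
    have h5 : |(Real.log (φ z.1.1) - Real.log (φ z.1.2)) / κ| ≤ 2 := by
      have : (Real.log (φ z.1.1) - Real.log (φ z.1.2)) / κ = (flowLift κ f z).2 - z.2 := by
        simp [flowLift, ← hφ]
      rw [this]
      exact (abs_sub _ _).trans (by linarith)
    rwa [abs_div, abs_of_pos hκ, div_le_iff₀ hκ] at h5
  have h5 := abs_le.1 h4
  have hexp : r * Real.exp (-κ) = Real.exp (Real.log r - κ) := by
    rw [sub_eq_add_neg, Real.exp_add, Real.exp_log hr]
  refine h.le_of_le hdiam hr (by positivity) hz ?_ ?_ x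
  · rw [hexp, ← Real.exp_log p1]
    exact Real.exp_le_exp.2 (by linarith)
  · rw [hexp, ← Real.exp_log p2]
    exact Real.exp_le_exp.2 (by linarith)

theorem measurePreserving_flowLift [MeasurableSpace Y] {m : Measure (Y × Y)} [SFinite m] (κ : ℝ)
    {f : Y → Y} (hf : MeasurePreserving (Prod.map f f) m m)
    (hm : Measurable (conformalFactor f)) :
    MeasurePreserving (flowLift κ f) (m.prod volume) (m.prod volume) := by
  refine hf.skew_product (g := fun q s =>
    s + (Real.log (conformalFactor f q.1) - Real.log (conformalFactor f q.2)) / κ) ?_ ?_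
  · refine measurable_snd.add (Measurable.div_const (Measurable.sub ?_ ?_) κ)
    · exact Real.measurable_log.comp (hm.comp (measurable_fst.comp measurable_fst))
    · exact Real.measurable_log.comp (hm.comp (measurable_snd.comp measurable_fst))
  · exact ae_of_all _ fun q => (measurePreserving_add_right volume _).map_eq

end ConformalFactor

/-! ### Local compactness and the lattice criterion -/

section Lattice

variable {Y : Type*} [MetricSpace Y] [CompactSpace Y]

/-- Near a given point the two auxiliary points of the explicit formula can be kept fixed. -/
theorem continuous_conformalFactor {T Y : Type*} [TopologicalSpace T] [MetricSpace Y]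
    (h3 : ∀ x : Y, ∃ y z : Y, x ≠ y ∧ x ≠ z ∧ y ≠ z) {f : T → Y → Y}
    (hf : Continuous fun q : T × Y => f q.1 q.2) (hinj : ∀ t, Function.Injective (f t))
    (hφ : ∀ t, ∃ φ, IsConformalFactor (f t) φ) :
    Continuous fun q : T × Y => conformalFactor (f q.1) q.2 := by
  refine continuous_iff_continuousAt.2 fun q => ?_
  obtain ⟨y, z, hy, hz, hyz⟩ := h3 q.2
  have h1 : (fun q : T × Y => conformalFactor (f q.1) q.2) =ᶠ[𝓝 q] fun q : T × Y =>
      dist (f q.1 q.2) (f q.1 y) * dist (f q.1 q.2) (f q.1 z) * dist y z /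
        (dist q.2 y * dist q.2 z * dist (f q.1 y) (f q.1 z)) := by
    have h2 : ∀ᶠ q' : T × Y in 𝓝 q, q'.2 ≠ y :=
      continuous_snd.continuousAt.eventually_ne hy
    have h2' : ∀ᶠ q' : T × Y in 𝓝 q, q'.2 ≠ z :=
      continuous_snd.continuousAt.eventually_ne hz
    filter_upwards [h2, h2'] with q' h4 h5
    exact (isConformalFactor_conformalFactor (hφ q'.1)).eq_div h4 h5 hyz
  refine ContinuousAt.congr ?_ h1.symm
  have c : ∀ x : Y, Continuous fun q : T × Y => f q.1 x := fun x =>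
    hf.comp (continuous_fst.prodMk continuous_const)
  refine ContinuousAt.div ?_ ?_ ?_
  · exact (((hf.dist (c y)).mul (hf.dist (c z))).mul continuous_const).continuousAt
  · exact (((continuous_snd.dist continuous_const).mul
      (continuous_snd.dist continuous_const)).mul ((c y).dist (c z))).continuousAt
  · exact mul_ne_zero (mul_ne_zero (dist_ne_zero.2 hy) (dist_ne_zero.2 hz))
      (dist_ne_zero.2 ((hinj q.1).ne hyz))

theorem IsConformalFactor.continuous {Y : Type*} [MetricSpace Y]
    (h3 : ∀ x : Y, ∃ y z : Y, x ≠ y ∧ x ≠ z ∧ y ≠ z) {f : Y ≃ₜ Y} {φ : Y → ℝ}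
    (hf : IsConformalFactor f φ) : Continuous φ := by
  rw [← hf.conformalFactor_eq h3]
  exact (continuous_conformalFactor (T := Unit) (f := fun _ => f) h3
    (f.continuous.comp continuous_snd) (fun _ => f.injective) fun _ => ⟨φ, hf⟩).comp
    (continuous_const (y := ()) |>.prodMk continuous_id)

theorem mem_lipschitzPart_of_le {Y : Type*} [MetricSpace Y] {H : Subgroup (Y ≃ₜ Y)}
    (hH : ∀ h : H, ∃ φ, IsConformalFactor (h : Y ≃ₜ Y) φ) {C : NNReal} {h : H}
    (h1 : ∀ x, conformalFactor (h : Y ≃ₜ Y) x ≤ C)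
    (h2 : ∀ x, conformalFactor ((h⁻¹ : H) : Y ≃ₜ Y) x ≤ C) : h ∈ lipschitzPart H C :=
  ⟨(isConformalFactor_conformalFactor (hH h)).lipschitzWith h1,
    (isConformalFactor_conformalFactor (hH h⁻¹)).lipschitzWith h2⟩

theorem exists_lipschitzPart_mem_nhds (h3 : ∀ x : Y, ∃ y z : Y, x ≠ y ∧ x ≠ z ∧ y ≠ z) [Nonempty Y]
    (hdiam : ∀ x y : Y, dist x y ≤ 1) {H : Subgroup (Y ≃ₜ Y)}
    (hH : ∀ h : H, ∃ φ, IsConformalFactor (h : Y ≃ₜ Y) φ) :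
    ∃ C : NNReal, lipschitzPart H C ∈ 𝓝 (1 : H) := by
  obtain ⟨a⟩ := ‹Nonempty Y›
  obtain ⟨b, c, hab, hac, hbc⟩ := h3 a
  obtain ⟨s, hs0, hs1, hs2, hs3⟩ : ∃ s, 0 < s ∧ s < dist a b ∧ s < dist a c ∧ s < dist b c := by
    have h1 := dist_pos.2 hab
    have h2 := dist_pos.2 hac
    have h3 := dist_pos.2 hbc
    obtain ⟨s, hs⟩ := exists_between (lt_min h1 (lt_min h2 h3))
    exact ⟨s, hs.1, hs.2.trans_le (min_le_left _ _),
      hs.2.trans_le ((min_le_right _ _).trans (min_le_left _ _)),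
      hs.2.trans_le ((min_le_right _ _).trans (min_le_right _ _))⟩
  -- If h keeps a, b, c more than s apart, then the factors of h at a, b and of h⁻¹ at ha, hb are at
  -- least s³; the constant is that of `IsConformalFactor.le_of_le` with c = s³ and r = s.
  refine ⟨⟨4 / (s ^ 3 * s ^ 2), by positivity⟩, ?_⟩
  have hev : ∀ u v : Y, s < dist u v →
      ∀ᶠ h : H in 𝓝 1, s < dist ((h : Y ≃ₜ Y) u) ((h : Y ≃ₜ Y) v) := by
    intro u v huv
    have hc : ∀ w : Y, Continuous fun h : H => (h : Y ≃ₜ Y) w := fun w =>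
      continuous_homeo_eval.comp (continuous_subtype_val.prodMk continuous_const)
    exact ((hc u).dist (hc v)).continuousAt.eventually (lt_mem_nhds huv)
  filter_upwards [hev a b hs1, hev a c hs2, hev b c hs3] with h k1 k2 k3
  have hinv : ∀ y, ((h⁻¹ : H) : Y ≃ₜ Y) ((h : Y ≃ₜ Y) y) = y := fun y => h.1.symm_apply_apply y
  refine mem_lipschitzPart_of_le hH (fun x => ?_) (fun x => ?_)
  · have hf := isConformalFactor_conformalFactor (hH h)
    refine hf.le_of_le hdiam hs0 (by positivity) hs1.le ?_ ?_ x
    · exact hf.ge_of_separated hdiam hs0 hab hac hs3.le k1.le k2.le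
    · refine hf.ge_of_separated hdiam hs0 hab.symm hbc hs2.le ?_ k3.le
      rw [dist_comm]
      exact k1.le
  · have hf := isConformalFactor_conformalFactor (hH h⁻¹)
    refine hf.le_of_le hdiam hs0 (by positivity) k1.le ?_ ?_ x
    · refine hf.ge_of_separated hdiam hs0 (h.1.injective.ne hab) (h.1.injective.ne hac) k3.le ?_ ?_
      · rw [hinv, hinv]; exact hs1.le
      · rw [hinv, hinv]; exact hs2.le
    · refine hf.ge_of_separated hdiam hs0 (h.1.injective.ne hab.symm) (h.1.injective.ne hbc)
        k2.le ?_ ?_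
      · rw [hinv, hinv, dist_comm]; exact hs1.le
      · rw [hinv, hinv]; exact hs3.le

theorem measure_offDiag_ne_zero [MeasurableSpace Y] [BorelSpace Y] (ν : Measure Y)
    [IsFiniteMeasure ν] [ν.IsOpenPosMeasure] (α : ℝ) {a b : Y} {r : ℝ} (hr : 0 < r)
    (hab : r < dist a b) : offDiagMeasure ν α {z | r ≤ dist z.1 z.2} ≠ 0 := by
  intro h
  rw [offDiagMeasure, withDensity_apply_eq_zero (measurable_ofReal_dist_rpow _)] at h
  have hopen : IsOpen {z : Y × Y | r < dist z.1 z.2} :=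
    isOpen_lt continuous_const (continuous_fst.dist continuous_snd)
  have hne : {z : Y × Y | r < dist z.1 z.2}.Nonempty := ⟨(a, b), hab⟩
  refine (hopen.measure_pos (ν.prod ν) hne).ne' ?_
  have h1 : ∀ z : Y × Y, r < dist z.1 z.2 → z.1 ≠ z.2 := fun z hz => dist_pos.1 (hr.trans hz)
  have h2 : {z : Y × Y | r < dist z.1 z.2} = {z | r < dist z.1 z.2} ∩ {z | z.1 ≠ z.2} := by
    ext z
    exact ⟨fun hz => ⟨hz, h1 z hz⟩, fun hz => hz.1⟩
  rw [h2, ← Measure.restrict_apply hopen.measurableSet]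
  have hsub : {z : Y × Y | r < dist z.1 z.2} ⊆
      {z | ENNReal.ofReal (dist z.1 z.2 ^ (-α)) ≠ 0} ∩ {z | r ≤ dist z.1 z.2} := by
    intro z hz
    have := dist_pos.2 (h1 z hz)
    have hz' : r < dist z.1 z.2 := hz
    refine ⟨?_, hz'.le⟩
    simp only [Set.mem_ofPred_eq, ne_eq, ENNReal.ofReal_eq_zero, not_le]
    positivity
  exact measure_mono_null hsub h

/-- A group of homeomorphisms that preserves `d ^ (-a) ν × ν` contains each of its discrete
subgroups of finite covolume on pairs of distinct points times `ℝ` as a lattice. -/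
theorem isLattice_of_finite_covolume [MeasurableSpace Y] [BorelSpace Y] [Nonempty Y]
    (h3 : ∀ x : Y, ∃ y z : Y, x ≠ y ∧ x ≠ z ∧ y ≠ z) (hdiam : ∀ x y : Y, dist x y ≤ 1)
    (ν : Measure Y) [IsFiniteMeasure ν] [ν.IsOpenPosMeasure] {a : ℝ} (ha : 0 < a)
    {H : Subgroup (Y ≃ₜ Y)}
    (hH : ∀ f, f ∈ H ↔ (offDiagMeasure ν a).map (Prod.map f f) = offDiagMeasure ν a)
    (L : Subgroup H) (hL : ∀ C, (lipschitzPart H C ∩ L).Finite) {κ : ℝ} (hκ : 0 < κ)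
    {F : Set ((Y × Y) × ℝ)} (hF : MeasurableSet F)
    (hFL : ∀ z : (Y × Y) × ℝ, z.1.1 ≠ z.1.2 → ∃ l ∈ L, flowLift κ (l : Y ≃ₜ Y) z ∈ F)
    (hFfin : (offDiagMeasure ν a).prod volume F < ⊤) : IsLattice L := by
  have hconf : ∀ h : H, ∃ φ, IsConformalFactor (h : Y ≃ₜ Y) φ := fun h =>
    exists_isConformalFactor_of_crossRatio h3 h.1.injective fun h1 h2 h3 h4 =>
      crossRatio_eq_of_map_offDiagMeasure ha h.1 ((hH _).1 h.2) h1 h2 h3 h4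
  obtain ⟨C₀, hC₀⟩ := exists_lipschitzPart_mem_nhds h3 hdiam hconf
  have hlc : LocallyCompactSpace H :=
    (isCompact_lipschitzPart ν ha hH C₀).locallyCompactSpace_of_mem_nhds_of_group hC₀
  have _ : SecondCountableTopology H := TopologicalSpace.Subtype.secondCountableTopology _
  have hdisc : DiscreteTopology L := by
    refine discreteTopology_of_isOpen_singleton_one ?_
    refine isOpen_singleton_of_finite_mem_nhds (s := Subtype.val ⁻¹' lipschitzPart H C₀) _ ?_ ?_
    · exact continuous_subtype_val.continuousAt.preimage_mem_nhds hC₀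
    · refine Set.Finite.of_finite_image (f := Subtype.val) ((hL C₀).subset ?_)
        Subtype.val_injective.injOn
      rintro _ ⟨l, hl, rfl⟩
      exact ⟨hl, l.2⟩
  have _ : SecondCountableTopology L := TopologicalSpace.Subtype.secondCountableTopology _
  have hcount : Countable L :=
    TopologicalSpace.separableSpace_iff_countable.1 inferInstance
  refine ⟨inferInstance, inferInstance, hlc, hdisc, ?_⟩
  let _ : MeasurableSpace H := borel H
  have _ : BorelSpace H := ⟨rfl⟩
  obtain ⟨D, hD, hDL⟩ := exists_measurable_fundamentalDomain L
  refine exists_invariant_measure_of_fundamentalDomain L hD hDL ?_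
  have hev : Continuous fun q : H × Y => (q.1 : Y ≃ₜ Y) q.2 :=
    continuous_homeo_eval.comp (continuous_subtype_val.prodMap continuous_id)
  have hcontφ := continuous_conformalFactor h3 hev (fun h => h.1.injective) hconf
  obtain ⟨x₀⟩ := ‹Nonempty Y›
  obtain ⟨y₀, -, hxy, -⟩ := h3 x₀
  obtain ⟨r, hr, hrd⟩ := exists_between (dist_pos.2 hxy)
  have hinv : ∀ (h : H) z, flowLift κ ((h⁻¹ : H) : Y ≃ₜ Y) (flowLift κ (h : Y ≃ₜ Y) z) = z := by
    intro h z
    rw [← flowLift_comp h3 κ (hconf _) (hconf _)]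
    have : ((h⁻¹ : H) : Y ≃ₜ Y) ∘ (h : Y ≃ₜ Y) = id := h.1.symm_comp_self
    rw [this, flowLift_id h3]
  let K : Set ((Y × Y) × ℝ) := {q | r ≤ dist q.1 q.2} ×ˢ Set.Icc (-1) 1
  refine haar_inv_fundamentalDomain_lt_top ((offDiagMeasure ν a).prod volume)
    (fun h : H => flowLift κ (h : Y ≃ₜ Y)) ?_ ?_ ?_ L hD hDL hF (K := K) ?_ hFfin ?_ ?_
    (isCompact_lipschitzPart ν ha hH ⟨4 / (r * Real.exp (-κ) * r ^ 2), by positivity⟩) ?_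
  · exact fun g h z => flowLift_comp h3 κ (hconf g) (hconf h) z
  · refine Continuous.measurable ?_
    have c1 : Continuous fun q : H × (Y × Y) × ℝ => (q.1, q.2.1.1) := by fun_prop
    have c2 : Continuous fun q : H × (Y × Y) × ℝ => (q.1, q.2.1.2) := by fun_prop
    have hlog : Continuous fun q : H × Y => Real.log (conformalFactor (q.1 : Y ≃ₜ Y) q.2) :=
      hcontφ.log fun q => ((isConformalFactor_conformalFactor (hconf q.1)).1 q.2).ne'
    exact ((hev.comp c1).prodMk (hev.comp c2)).prodMk ((continuous_snd.comp continuous_snd).add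
      (((hlog.comp c1).sub (hlog.comp c2)).div_const κ))
  · refine fun h => measurePreserving_flowLift κ
      ⟨h.1.measurable.prodMap h.1.measurable, (hH _).1 h.2⟩ ?_
    exact (hcontφ.comp (continuous_const.prodMk continuous_id)).measurable
  · exact (isClosed_le continuous_const
      (continuous_fst.dist continuous_snd)).measurableSet.prod measurableSet_Icc
  · rw [Measure.prod_prod]
    refine mul_ne_zero (measure_offDiag_ne_zero ν a hr hrd) ?_
    simp
  · have : ∀ᵐ z ∂((offDiagMeasure ν a).prod (volume : Measure ℝ)), z.1.1 ≠ z.1.2 :=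
      Measure.quasiMeasurePreserving_fst.ae (offDiagMeasure_ae_ne ν a)
    exact this.mono fun z hz => hFL z hz
  · intro h z hz hhz
    -- The same bound serves for h⁻¹, which takes the point hz of K back to the point z of K.
    refine mem_lipschitzPart_of_le hconf
      (le_conformalFactor_of_flowLift hdiam hκ (hconf h) hr hz.1 (abs_le.2 hz.2) hhz.1
        (abs_le.2 hhz.2))
      (le_conformalFactor_of_flowLift hdiam hκ (hconf h⁻¹) hr hhz.1 (abs_le.2 hhz.2) ?_ ?_)
    · have := hinv h z
      have h1 := congrArg Prod.fst this
      change r ≤ dist (flowLift κ ((h⁻¹ : H) : Y ≃ₜ Y) (flowLift κ (h : Y ≃ₜ Y) z)).1.1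
        (flowLift κ ((h⁻¹ : H) : Y ≃ₜ Y) (flowLift κ (h : Y ≃ₜ Y) z)).1.2
      rw [this]
      exact hz.1
    · rw [hinv]
      exact abs_le.2 hz.2

end Lattice

/-! ### Visual metrics, Busemann functions and the dynamics on the boundary -/

section Geometry

variable {X : Type*} [MetricSpace X]

theorem gromovProduct_nonneg (p x y : X) : 0 ≤ gromovProduct p x y := by
  have := dist_triangle x p y
  have := dist_comm x p
  simp only [gromovProduct]
  linarith

theorem gromovProduct_base_change (p q x y : X) : gromovProduct q x y =
    gromovProduct p x y - ((dist p x - dist q x) + (dist p y - dist q y)) / 2 := by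
  simp only [gromovProduct]; ring

theorem tendsto_exp_of_tendsto_ofReal {ε : ℝ} (hε : 0 < ε) {g : ℕ → ℝ} (hg : ∀ n, 0 ≤ g n) {L : ℝ≥0∞}
    (h : Tendsto (fun n => ENNReal.ofReal (g n)) atTop (𝓝 L)) :
    Tendsto (fun n => Real.exp (-ε * g n)) atTop
      (𝓝 (if L = ⊤ then 0 else Real.exp (-ε * L.toReal))) := by
  split_ifs with hL
  · subst hL
    have h1 : Tendsto g atTop atTop := by
      refine tendsto_atTop.2 fun b => ?_
      filter_upwards [(ENNReal.tendsto_nhds_top_iff_nnreal.1 h) b.toNNReal] with n hn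
      exact (ENNReal.ofReal_lt_ofReal_iff'.1 hn).1.le
    refine Real.tendsto_exp_atBot.comp ?_
    exact h1.const_mul_atTop_of_neg (neg_lt_zero.2 hε)
  · have h1 := (ENNReal.tendsto_toReal hL).comp h
    have h2 : Tendsto g atTop (𝓝 L.toReal) := h1.congr fun n => ENNReal.toReal_ofReal (hg n)
    exact (Real.continuous_exp.tendsto _).comp (h2.const_mul (-ε))

variable [GromovHyperbolic X] {ε : ℝ}

theorem tendsto_boundaryProduct (hX : IsGood X ε) (p : X) {ξ η : GromovBoundary X} {x y : ℕ → X}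
    (hx : ConvergesTo x ξ) (hy : ConvergesTo y η) :
    Tendsto (fun n => ENNReal.ofReal (gromovProduct p (x n) (y n))) atTop
      (𝓝 (boundaryProduct p ξ η)) := by
  obtain ⟨L, hL⟩ := hX.extends_continuously p (Sum.inr ξ) (Sum.inr η)
  have h : boundaryProduct p ξ η = L := by
    refine le_antisymm ?_ ?_
    · refine (iInf₂_le x hx).trans ((iInf₂_le y hy).trans ?_)
      exact (hL x y hx hy).liminf_eq.le
    · exact le_iInf₂ fun x' hx' => le_iInf₂ fun y' hy' => (hL x' y' hx' hy').liminf_eq.ge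
  rw [h]
  exact hL x y hx hy

theorem tendsto_visualDist (hε : 0 < ε) (hX : IsGood X ε) (p : X) {ξ η : GromovBoundary X}
    {x y : ℕ → X} (hx : ConvergesTo x ξ) (hy : ConvergesTo y η) :
    Tendsto (fun n => Real.exp (-ε * gromovProduct p (x n) (y n))) atTop
      (𝓝 (visualDist p ε ξ η)) :=
  tendsto_exp_of_tendsto_ofReal hε (fun _ => gromovProduct_nonneg _ _ _)
    (tendsto_boundaryProduct hX p hx hy)

theorem visualDist_nonneg (p : X) (ε : ℝ) (ξ η : GromovBoundary X) : 0 ≤ visualDist p ε ξ η := by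
  unfold visualDist
  split_ifs
  · exact le_rfl
  · positivity

theorem visualDist_le_one (hε : 0 < ε) (p : X) (ξ η : GromovBoundary X) :
    visualDist p ε ξ η ≤ 1 := by
  unfold visualDist
  split_ifs
  · exact zero_le_one
  · refine Real.exp_le_one_iff.2 ?_
    have := mul_nonneg hε.le (ENNReal.toReal_nonneg (a := boundaryProduct p ξ η))
    linarith

theorem visualDist_base_change (hε : 0 < ε) (hX : IsGood X ε) (p q : X) (ξ η : GromovBoundary X) :
    visualDist q ε ξ η =
      visualDist p ε ξ η * Real.exp (ε / 2 * (busemann ξ p q + busemann η p q)) := by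
  have hx := convergesTo_out ξ
  have hy := convergesTo_out η
  refine tendsto_nhds_unique (tendsto_visualDist hε hX q hx hy) ?_
  have h := (tendsto_visualDist hε hX p hx hy).mul ((Real.continuous_exp.tendsto _).comp
    (((tendsto_busemann hX hx p q).add (tendsto_busemann hX hy p q)).const_mul (ε / 2)))
  refine h.congr fun n => ?_
  rw [Function.comp, ← Real.exp_add, gromovProduct_base_change p q]
  congr 1
  ring

theorem abs_busemann_le (hX : IsGood X ε) (ξ : GromovBoundary X) (p q : X) :
    |busemann ξ p q| ≤ dist p q :=
  le_of_tendsto' (tendsto_busemann hX (convergesTo_out ξ) p q).abs fun _ => abs_dist_sub_le _ _ _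

theorem busemann_map (hX : IsGood X ε) (g : X ≃ᵢ X) (ξ : GromovBoundary X) (p q : X) :
    busemann (boundaryMap g ξ) (g p) (g q) = busemann ξ p q := by
  have hx := convergesTo_out ξ
  refine tendsto_nhds_unique (tendsto_busemann hX (hx.map g) (g p) (g q)) ?_
  simpa only [g.dist_eq] using tendsto_busemann hX hx p q

theorem busemann_comm (hX : IsGood X ε) (ξ : GromovBoundary X) (p q : X) :
    busemann ξ p q = -busemann ξ q p := by
  have hx := convergesTo_out ξ
  refine tendsto_nhds_unique (tendsto_busemann hX hx p q) ?_
  exact (tendsto_busemann hX hx q p).neg.congr fun n => by ring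

theorem visualDist_map (hε : 0 < ε) (hX : IsGood X ε) (g : X ≃ᵢ X) (p : X)
    (ξ η : GromovBoundary X) :
    visualDist (g p) ε (boundaryMap g ξ) (boundaryMap g η) = visualDist p ε ξ η := by
  have hx := convergesTo_out ξ
  have hy := convergesTo_out η
  refine tendsto_nhds_unique (tendsto_visualDist hε hX (g p) (hx.map g) (hy.map g)) ?_
  simpa only [gromovProduct_map] using tendsto_visualDist hε hX p hx hy

/-- The geometric mean value property. -/
theorem visualDist_boundaryMap (hε : 0 < ε) (hX : IsGood X ε) (g : X ≃ᵢ X) (p : X)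
    (ξ η : GromovBoundary X) :
    visualDist p ε (boundaryMap g ξ) (boundaryMap g η) = visualDist p ε ξ η *
      Real.exp (ε / 2 * (busemann ξ p (g⁻¹ p) + busemann η p (g⁻¹ p))) := by
  rw [← visualDist_base_change hε hX, ← visualDist_map hε hX g (g⁻¹ p)]
  congr 1
  exact (g.apply_symm_apply p).symm

/-- The topology quantifies over all base points, but a change from p to q alters the visual metric
by a factor of at most exp(ε d(p,q)), so one base point suffices. -/
theorem isOpen_iff_visualDist (hε : 0 < ε) (hX : IsGood X ε) (p : X)
    (U : Set (GromovBoundary X)) :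
    IsOpen U ↔ ∀ ξ ∈ U, ∃ r > 0, ∀ η, visualDist p ε ξ η < r → η ∈ U := by
  have hlt : ∀ (q : X) (ξ η : GromovBoundary X) (t : ℝ), 0 ≤ t →
      (visualDist q ε ξ η < Real.exp (-ε * t) ↔ ENNReal.ofReal t < boundaryProduct q ξ η) := by
    intro q ξ η t ht
    unfold visualDist
    split_ifs with h
    · simp [h, Real.exp_pos]
    · rw [Real.exp_lt_exp, ← ENNReal.ofReal_toReal h, ENNReal.ofReal_lt_ofReal_iff_of_nonneg ht,
        ENNReal.ofReal_toReal h]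
      constructor
      · intro h1
        nlinarith
      · intro h1
        nlinarith
  constructor
  · intro hU ξ hξ
    obtain ⟨t, ht⟩ := hU p ξ hξ
    refine ⟨Real.exp (-ε * max t 0), Real.exp_pos _, fun η hη => ht η ?_⟩
    exact (ENNReal.ofReal_le_ofReal (le_max_left t 0)).trans_lt
      ((hlt p ξ η _ (le_max_right t 0)).1 hη)
  · intro hU q ξ hξ
    obtain ⟨r, hr, hrU⟩ := hU ξ hξ
    set t := max 0 (dist q p - Real.log r / ε) with ht
    refine ⟨t, fun η hη => hrU η ?_⟩
    rw [← hlt q ξ η t (le_max_left _ _)] at hη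
    rw [visualDist_base_change hε hX q p]
    have h1 := (abs_le.1 (abs_busemann_le hX ξ q p)).2
    have h2 := (abs_le.1 (abs_busemann_le hX η q p)).2
    calc visualDist q ε ξ η * Real.exp (ε / 2 * (busemann ξ q p + busemann η q p))
        < Real.exp (-ε * t) * Real.exp (ε / 2 * (busemann ξ q p + busemann η q p)) :=
          mul_lt_mul_of_pos_right hη (Real.exp_pos _)
      _ = Real.exp (-ε * t + ε / 2 * (busemann ξ q p + busemann η q p)) := (Real.exp_add _ _).symm
      _ ≤ Real.exp (Real.log r) := by
          refine Real.exp_le_exp.2 ?_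
          have h3 : ε * (dist q p - Real.log r / ε) ≤ ε * t :=
            mul_le_mul_of_nonneg_left (le_max_right _ _) hε.le
          have h4 : ε * (dist q p - Real.log r / ε) = ε * dist q p - Real.log r := by
            field_simp
          have h5 : ε / 2 * (busemann ξ q p + busemann η q p) ≤ ε / 2 * (dist q p + dist q p) := by
            gcongr
          linarith
      _ = r := Real.exp_log hr

/-- The visual metric on the boundary. -/
noncomputable abbrev boundaryMetric (hε : 0 < ε) (hX : IsGood X ε) (p : X) :
    MetricSpace (GromovBoundary X) :=
  MetricSpace.ofDistTopology (visualDist p ε) (fun ξ => (hX.eq_zero_iff p ξ ξ).2 rfl)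
    (hX.symm p) (hX.triangle p) (isOpen_iff_visualDist hε hX p)
    fun ξ η h => (hX.eq_zero_iff p ξ η).1 h

/-- The Gromov product of a boundary point and a point of the space. -/
noncomputable def mixedProduct (p : X) (ξ : GromovBoundary X) (q : X) : ℝ :=
  (dist p q + busemann ξ p q) / 2

theorem tendsto_mixedProduct (hX : IsGood X ε) (p q : X) {ξ : GromovBoundary X} {x : ℕ → X}
    (hx : ConvergesTo x ξ) :
    Tendsto (fun n => gromovProduct p (x n) q) atTop (𝓝 (mixedProduct p ξ q)) := by
  refine (((tendsto_busemann hX hx p q).const_add (dist p q)).div_const 2).congr fun n => ?_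
  simp only [gromovProduct, dist_comm (x n) q]
  ring

/-- This is the source of the contraction: when d(p,gp) is large, gξ is close to gp as seen from p,
unless ξ is close to g⁻¹p. -/
theorem mixedProduct_map (hX : IsGood X ε) (g : X ≃ᵢ X) (p : X) (ξ : GromovBoundary X) :
    mixedProduct p (boundaryMap g ξ) (g p) = dist p (g p) - mixedProduct p ξ (g⁻¹ p) := by
  have h1 : g (g⁻¹ p) = p := g.apply_symm_apply p
  have h2 := busemann_map hX g ξ (g⁻¹ p) p
  rw [h1, busemann_comm hX ξ] at h2
  have h3 : dist p (g⁻¹ p) = dist p (g p) := by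
    rw [← g.dist_eq p, h1, dist_comm]
  simp only [mixedProduct, h2, h3]
  ring

/-- The four-point inequality with middle point q, passed to the limit and exponentiated. Distinct
boundary points therefore cannot both have a large product with the same q. -/
theorem visualDist_le_max (hε : 0 < ε) (hX : IsGood X ε) : ∃ c : ℝ, ∀ (p q : X)
    (ξ η : GromovBoundary X), visualDist p ε ξ η ≤
      Real.exp (ε * c - ε * min (mixedProduct p ξ q) (mixedProduct p η q)) := by
  obtain ⟨c, hc⟩ := GromovHyperbolic.exists_const (X := X)
  refine ⟨c, fun p q ξ η => ?_⟩
  have hx := convergesTo_out ξ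
  have hy := convergesTo_out η
  refine le_of_tendsto_of_tendsto' (tendsto_visualDist hε hX p hx hy)
    ((Real.continuous_exp.tendsto _).comp (((tendsto_mixedProduct hX p q hx).min
      (tendsto_mixedProduct hX p q hy)).const_mul ε |>.const_sub (ε * c))) fun n => ?_
  refine Real.exp_le_exp.2 ?_
  have h := hc p (ξ.out.1 n) q (η.out.1 n)
  have h1 : gromovProduct p q (η.out.1 n) = gromovProduct p (η.out.1 n) q := by
    simp only [gromovProduct, dist_comm q]; ring
  rw [h1] at h
  have := mul_le_mul_of_nonneg_left h hε.le
  simp only at this ⊢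
  linarith

theorem tendsto_mixedProduct_atTop (hX : IsGood X ε) {p : X} {ξ : GromovBoundary X} {x : ℕ → X}
    (hx : ConvergesTo x ξ) : Tendsto (fun n => mixedProduct p ξ (x n)) atTop atTop := by
  refine tendsto_atTop.2 fun b => ?_
  have h := (tendsto_atTop.1 (hx.choose p)) b
  rw [← prod_atTop_atTop_eq, eventually_prod_iff] at h
  obtain ⟨P, hP, Q, hQ, hPQ⟩ := h
  filter_upwards [hQ] with n hn
  refine ge_of_tendsto (tendsto_mixedProduct hX p (x n) hx) ?_
  filter_upwards [hP] with m hm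
  exact hPQ hm hn

/-- Of two distinct points of the boundary, one at least is moved near to any given limit point. -/
theorem exists_boundaryMap_near (hε : 0 < ε) (hX : IsGood X ε) {Γ : Subgroup (X ≃ᵢ X)}
    {ξ : GromovBoundary X} (hξ : ξ ∈ limitSet Γ) {U : Set (GromovBoundary X)} (hU : IsOpen U)
    (hξU : ξ ∈ U) {a b : GromovBoundary X} (hab : a ≠ b) :
    ∃ γ : Γ, boundaryMap γ.1 a ∈ U ∨ boundaryMap γ.1 b ∈ U := by
  obtain ⟨x, g, hg⟩ := hξ
  obtain ⟨r, hr, hrU⟩ := (isOpen_iff_visualDist hε hX x U).1 hU ξ hξU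
  obtain ⟨c, hc⟩ := visualDist_le_max hε hX
  have hv : 0 < visualDist x ε a b :=
    lt_of_le_of_ne (visualDist_nonneg _ _ _ _) fun h => hab ((hX.eq_zero_iff x a b).1 h.symm)
  set B := c - Real.log (visualDist x ε a b) / ε with hB
  have hmin : ∀ q, min (mixedProduct x a q) (mixedProduct x b q) ≤ B := by
    intro q
    have h := Real.log_le_log hv (hc x q a b)
    rw [Real.log_exp] at h
    rw [hB, le_sub_iff_add_le, ← le_sub_iff_add_le', div_le_iff₀ hε]
    linarith
  have h1 := tendsto_mixedProduct_atTop hX (p := x) hg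
  have h2 : Tendsto (fun n => dist x ((g n).1 x)) atTop atTop := by
    refine tendsto_atTop_mono (fun n => ?_) h1
    have := (abs_le.1 (abs_busemann_le hX ξ x ((g n).1 x))).2
    simp only [mixedProduct]
    linarith
  -- Chosen so that exp(εc - εt) = r exp(-ε) < r.
  set t := c - Real.log r / ε + 1 with ht
  obtain ⟨n, hn1, hn2⟩ := ((tendsto_atTop.1 h1 t).and (tendsto_atTop.1 h2 (t + B))).exists
  have main : ∀ u, mixedProduct x u ((g n).1⁻¹ x) ≤ B → boundaryMap (g n).1 u ∈ U := by
    intro u hu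
    refine hrU _ ((hc x ((g n).1 x) ξ _).trans_lt ?_)
    rw [mixedProduct_map hX]
    have h3 : t ≤ min (mixedProduct x ξ ((g n).1 x))
        (dist x ((g n).1 x) - mixedProduct x u ((g n).1⁻¹ x)) :=
      le_min hn1 (by linarith)
    rw [← Real.lt_log_iff_exp_lt hr]
    have h4 := mul_le_mul_of_nonneg_left h3 hε.le
    have h5 : ε * t = ε * c - Real.log r + ε := by
      rw [ht]; field_simp
    linarith
  refine ⟨g n, ?_⟩
  rcases min_le_iff.1 (hmin ((g n).1⁻¹ x)) with h | h
  · exact Or.inl (main a h)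
  · exact Or.inr (main b h)

/-- The isometries whose conformal factors are bounded below at two boundary points move the base
point by a bounded amount. -/
theorem exists_dist_le_of_le_busemann (hε : 0 < ε) (hX : IsGood X ε) (p : X)
    {a b : GromovBoundary X} (hab : a ≠ b) (B : ℝ) :
    ∃ R, ∀ q, B ≤ busemann a p q → B ≤ busemann b p q → dist p q < R := by
  obtain ⟨c, hc⟩ := visualDist_le_max hε hX
  have hv : 0 < visualDist p ε a b :=
    lt_of_le_of_ne (visualDist_nonneg _ _ _ _) fun h => hab ((hX.eq_zero_iff p a b).1 h.symm)
  refine ⟨2 * (c - Real.log (visualDist p ε a b) / ε) - B + 1, fun q h1 h2 => ?_⟩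
  have h3 : (dist p q + B) / 2 ≤ min (mixedProduct p a q) (mixedProduct p b q) :=
    le_min (by simp only [mixedProduct]; linarith) (by simp only [mixedProduct]; linarith)
  have h := Real.log_le_log hv (hc p q a b)
  rw [Real.log_exp] at h
  have h4 : min (mixedProduct p a q) (mixedProduct p b q) ≤
      c - Real.log (visualDist p ε a b) / ε := by
    rw [le_sub_iff_add_le, ← le_sub_iff_add_le', div_le_iff₀ hε]
    linarith
  linarith

end Geometry

/-! ### Lower bounds for conformal factors, and conformal measures -/

section Conformal

variable {Y : Type*} [MetricSpace Y]

theorem IsConformalFactor.le_of_lipschitzWith (h3 : ∀ x : Y, ∃ y z : Y, x ≠ y ∧ x ≠ z ∧ y ≠ z)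
    {f : Y ≃ₜ Y} {φ : Y → ℝ} (hf : IsConformalFactor f φ) {C : NNReal} (h1 : LipschitzWith C f)
    (h2 : LipschitzWith C f.symm) (x : Y) : ((C : ℝ) ^ 3)⁻¹ ≤ φ x := by
  obtain ⟨y, z, hxy, hxz, hyz⟩ := h3 x
  rw [hf.eq_div hxy hxz hyz]
  have p1 := dist_pos.2 hxy
  have p2 := dist_pos.2 hxz
  have p3 := dist_pos.2 (f.injective.ne hyz)
  have k1 := h2.dist_le_mul (f x) (f y)
  have k2 := h2.dist_le_mul (f x) (f z)
  have k3 := h1.dist_le_mul y z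
  rw [f.symm_apply_apply, f.symm_apply_apply] at k1 k2
  have hC : 0 < (C : ℝ) := by
    refine lt_of_le_of_ne C.coe_nonneg fun h => ?_
    rw [← h, zero_mul] at k1
    linarith
  rw [le_div_iff₀ (by positivity), inv_mul_le_iff₀ (by positivity)]
  calc dist x y * dist x z * dist (f y) (f z)
      ≤ (C * dist (f x) (f y)) * (C * dist (f x) (f z)) * (C * dist y z) := by gcongr
    _ = _ := by ring

/-- The Jacobian φ(x)^(a/2) φ(y)^(a/2) of ν × ν cancels exactly the factor by which d^(-a) changes
under f; the exponent is a/2 because φ(x)φ(y) scales the square of d. -/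
theorem map_offDiagMeasure_symm [MeasurableSpace Y] [BorelSpace Y] [SecondCountableTopology Y]
    {ν : Measure Y} [IsFiniteMeasure ν] {a : ℝ} {f : Y ≃ₜ Y} {φ : Y → ℝ}
    (hf : IsConformalFactor f φ) (hφ : Measurable φ)
    (hν : ν.map f.symm = ν.withDensity fun x => ENNReal.ofReal (φ x ^ (a / 2))) :
    (offDiagMeasure ν a).map (Prod.map f.symm f.symm) = offDiagMeasure ν a := by
  set J : Y → ℝ≥0∞ := fun x => ENNReal.ofReal (φ x ^ (a / 2)) with hJ
  have hJm : Measurable J := (hφ.pow_const _).ennreal_ofReal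
  have hs : Measurable (Prod.map f.symm f.symm) := f.symm.measurable.prodMap f.symm.measurable
  have hfm : Measurable (Prod.map f f) := f.measurable.prodMap f.measurable
  set w : Y × Y → ℝ≥0∞ := fun z => ENNReal.ofReal (dist z.1 z.2 ^ (-a)) with hw
  have hwm : Measurable w := measurable_ofReal_dist_rpow (-a)
  have hprod : (ν.prod ν).map (Prod.map f.symm f.symm) =
      (ν.prod ν).withDensity fun z => J z.1 * J z.2 := by
    have : SFinite (ν.withDensity J) := by rw [← hν]; infer_instance
    rw [← Measure.map_prod_map _ _ f.symm.measurable f.symm.measurable, hν,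
      prod_withDensity hJm hJm]
  refine Measure.ext fun E hE => ?_
  have hE' := hs hE
  have hoff : MeasurableSet {z : Y × Y | z.1 ≠ z.2} := measurableSet_offDiag
  let G : Y × Y → ℝ≥0∞ := ({z : Y × Y | z.1 ≠ z.2} ∩ E).indicator fun z => w (Prod.map f f z)
  have hG : Measurable G := (hwm.comp hfm).indicator (hoff.inter hE)
  have hfs : ∀ z : Y × Y, Prod.map f f (Prod.map f.symm f.symm z) = z := fun z => by
    simp [Prod.map]
  rw [Measure.map_apply hs hE, offDiagMeasure, withDensity_apply _ hE', withDensity_apply _ hE,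
    Measure.restrict_restrict hE', Measure.restrict_restrict hE]
  calc ∫⁻ z in Prod.map f.symm f.symm ⁻¹' E ∩ {z | z.1 ≠ z.2}, w z ∂(ν.prod ν)
      = ∫⁻ z, G (Prod.map f.symm f.symm z) ∂(ν.prod ν) := by
        rw [← lintegral_indicator (hE'.inter hoff)]
        refine lintegral_congr fun z => ?_
        by_cases hz : z ∈ Prod.map f.symm f.symm ⁻¹' E ∩ {z | z.1 ≠ z.2}
        · have hz' : Prod.map f.symm f.symm z ∈ {z : Y × Y | z.1 ≠ z.2} ∩ E :=
            ⟨f.symm.injective.ne hz.2, hz.1⟩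
          rw [Set.indicator_of_mem hz]
          simp only [G]
          rw [Set.indicator_of_mem hz', hfs]
        · have hz' : Prod.map f.symm f.symm z ∉ {z : Y × Y | z.1 ≠ z.2} ∩ E := fun h =>
            hz ⟨h.2, fun h' => h.1 (congrArg f.symm h')⟩
          rw [Set.indicator_of_notMem hz]
          simp only [G]
          rw [Set.indicator_of_notMem hz']
    _ = ∫⁻ z, (fun z => J z.1 * J z.2) z * G z ∂(ν.prod ν) := by
        rw [← lintegral_map hG hs, hprod]
        exact lintegral_withDensity_eq_lintegral_mul _
          ((hJm.comp measurable_fst).mul (hJm.comp measurable_snd)) hG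
    _ = ∫⁻ z in E ∩ {z | z.1 ≠ z.2}, w z ∂(ν.prod ν) := by
        rw [← lintegral_indicator (hE.inter hoff), Set.inter_comm E]
        refine lintegral_congr fun z => ?_
        by_cases hz : z ∈ {z : Y × Y | z.1 ≠ z.2} ∩ E
        · simp only [G]
          rw [Set.indicator_of_mem hz, Set.indicator_of_mem hz]
          have p1 := hf.1 z.1
          have p2 := hf.1 z.2
          have p3 : 0 < dist z.1 z.2 := dist_pos.2 hz.1
          have p4 : 0 < dist (f z.1) (f z.2) := dist_pos.2 (f.injective.ne hz.1)
          simp only [hJ, hw, Prod.map]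
          rw [← ENNReal.ofReal_mul (by positivity), ← ENNReal.ofReal_mul (by positivity)]
          congr 1
          have h1 : dist (f z.1) (f z.2) ^ a = φ z.1 ^ (a / 2) * φ z.2 ^ (a / 2) *
              dist z.1 z.2 ^ a := by
            have h2 := congrArg (· ^ (a / 2)) (hf.2 z.1 z.2)
            rw [Real.mul_rpow (by positivity) (by positivity),
              Real.mul_rpow (by positivity) (by positivity), ← Real.rpow_natCast_mul dist_nonneg,
              ← Real.rpow_natCast_mul dist_nonneg] at h2
            have h3 : ((2 : ℕ) : ℝ) * (a / 2) = a := by push_cast; ring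
            rwa [h3] at h2
          rw [Real.rpow_neg p4.le, Real.rpow_neg p3.le, h1]
          field_simp
        · simp only [G]
          rw [Set.indicator_of_notMem hz, Set.indicator_of_notMem hz, mul_zero]

end Conformal

/-! ### The group Γ on its limit set -/

section Group

variable {X : Type*} [MetricSpace X] [GromovHyperbolic X] {ε : ℝ}

theorem limitHomeo_inv (Γ : Subgroup (X ≃ᵢ X)) (γ : Γ) :
    limitHomeo Γ γ⁻¹ = (limitHomeo Γ γ).symm := rfl

theorem mem_range_restrictHom {Γ : Subgroup (X ≃ᵢ X)} {f : limitSet Γ ≃ₜ limitSet Γ} :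
    f ∈ (restrictHom Γ).range ↔ ∃ γ : Γ, limitHomeo Γ γ = f := by
  constructor
  · rintro ⟨⟨_, g, hg, rfl⟩, rfl⟩
    exact ⟨⟨g, hg⟩, rfl⟩
  · rintro ⟨γ, rfl⟩
    exact ⟨_, rfl⟩

theorem MetricallyProper.countable {X : Type*} [MetricSpace X] [Nonempty X] {Γ : Subgroup (X ≃ᵢ X)} (hΓ : MetricallyProper Γ) :
    Countable Γ := by
  obtain ⟨x⟩ := ‹Nonempty X›
  refine Set.countable_univ_iff.1 ?_
  have : (Set.univ : Set Γ) = ⋃ n : ℕ, {γ : Γ | dist x (γ.1 x) < n} := by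
    ext γ
    obtain ⟨n, hn⟩ := exists_nat_gt (dist x (γ.1 x))
    exact ⟨fun _ => Set.mem_iUnion.2 ⟨n, hn⟩, fun _ => trivial⟩
  rw [this]
  exact Set.countable_iUnion fun n => (hΓ x n).countable

/-- A Patterson–Sullivan measure has full support, provided that it is not concentrated in
a point. -/
theorem isOpenPosMeasure_of_conformal (hε : 0 < ε) (hX : IsGood X ε) (p : X)
    {Γ : Subgroup (X ≃ᵢ X)} [Countable Γ] {δ : ℝ} {ν : Measure (limitSet Γ)} [SFinite ν]
    (hν : ∀ γ : Γ, ν.map (limitHomeo Γ γ⁻¹) =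
      ν.withDensity fun ξ => ENNReal.ofReal (Real.exp (δ * busemann ξ.1 p (γ.1⁻¹ p))))
    (hne : (ν.prod ν) {z | z.1 ≠ z.2} ≠ 0) : ν.IsOpenPosMeasure := by
  refine ⟨fun U hU hUne hU0 => hne ?_⟩
  -- By quasi-invariance all translates of a null open set are null, and every pair of distinct
  -- points has a coordinate in their union W.
  set W : Set (limitSet Γ) := ⋃ γ : Γ, limitHomeo Γ γ ⁻¹' U with hW
  have hW0 : ν W = 0 := by
    refine measure_iUnion_null fun γ => ?_
    rw [← Measure.map_apply (limitHomeo Γ γ).measurable hU.measurableSet]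
    have h := hν γ⁻¹
    rw [inv_inv] at h
    rw [h]
    exact withDensity_absolutelyContinuous _ _ hU0
  have hsub : {z : limitSet Γ × limitSet Γ | z.1 ≠ z.2} ⊆
      (W ×ˢ Set.univ) ∪ (Set.univ ×ˢ W) := by
    intro z hz
    obtain ⟨ξ, hξ⟩ := hUne
    obtain ⟨V, hV, rfl⟩ := isOpen_induced_iff.1 hU
    obtain ⟨γ, h⟩ := exists_boundaryMap_near hε hX ξ.2 hV hξ (a := z.1.1) (b := z.2.1)
      fun h => hz (Subtype.ext h)
    rcases h with h | h
    · exact Or.inl ⟨Set.mem_iUnion.2 ⟨γ, h⟩, trivial⟩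
    · exact Or.inr ⟨trivial, Set.mem_iUnion.2 ⟨γ, h⟩⟩
  refine measure_mono_null hsub (measure_union_null ?_ ?_)
  · rw [Measure.prod_prod, hW0, zero_mul]
  · rw [Measure.prod_prod, hW0, mul_zero]

theorem isConformalFactor_limitHomeo (hε : 0 < ε) (hX : IsGood X ε) (p : X)
    {Γ : Subgroup (X ≃ᵢ X)} (γ : Γ) :
    letI := boundaryMetric hε hX p
    IsConformalFactor (limitHomeo Γ γ) fun ξ => Real.exp (ε * busemann ξ.1 p (γ.1⁻¹ p)) := by
  let _ := boundaryMetric hε hX p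
  refine ⟨fun _ => Real.exp_pos _, fun ξ η => ?_⟩
  have h := visualDist_boundaryMap hε hX γ.1 p ξ.1 η.1
  change visualDist p ε (boundaryMap γ.1 ξ.1) (boundaryMap γ.1 η.1) ^ 2 =
    _ * visualDist p ε ξ.1 η.1 ^ 2
  rw [h, mul_pow, ← Real.exp_nat_mul, ← Real.exp_add, mul_comm]
  congr 2
  push_cast
  ring

theorem finite_of_not_three {Y : Type*} (h : ¬ ∀ x : Y, ∃ y z : Y, x ≠ y ∧ x ≠ z ∧ y ≠ z) :
    Finite Y := by
  push Not at h
  obtain ⟨x, hx⟩ := h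
  by_cases hy : ∃ y, x ≠ y
  · obtain ⟨y, hy⟩ := hy
    refine Set.finite_univ_iff.1 ((Set.toFinite {x, y}).subset fun z _ => ?_)
    by_cases hz : x = z
    · exact Or.inl hz.symm
    · exact Or.inr (hx y z hy hz).symm
  · push Not at hy
    exact Set.finite_univ_iff.1 ((Set.finite_singleton x).subset fun z _ => (hy z).symm)

theorem limitHomeo_mem_preservingGroup (hε : 0 < ε) (hX : IsGood X ε) (p : X)
    {Γ : Subgroup (X ≃ᵢ X)} (hcpt : CompactSpace (limitSet Γ)) {δ : ℝ} {ν : Measure (limitSet Γ)}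
    (hν : IsPattersonSullivan Γ p δ ν) (γ : Γ) :
    limitHomeo Γ γ ∈ preservingGroup Γ p ε δ ν := by
  let _ : MetricSpace (GromovBoundary X) := boundaryMetric hε hX p
  have hprob := hν.isProbabilityMeasure
  have hconf := isConformalFactor_limitHomeo hε hX p γ
  have hm : Measurable fun ξ : limitSet Γ => Real.exp (ε * busemann ξ.1 p (γ.1⁻¹ p)) := by
    by_cases h3 : ∀ x : limitSet Γ, ∃ y z : limitSet Γ, x ≠ y ∧ x ≠ z ∧ y ≠ z
    · exact (hconf.continuous h3).measurable
    · have := finite_of_not_three h3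
      exact measurable_of_finite _
  have hJ : ν.map (limitHomeo Γ γ).symm = ν.withDensity fun ξ =>
      ENNReal.ofReal (Real.exp (ε * busemann ξ.1 p (γ.1⁻¹ p)) ^ (2 * δ / ε / 2)) := by
    rw [← limitHomeo_inv, hν.conformal γ]
    congr 1
    funext ξ
    rw [← Real.exp_mul]
    congr 2
    field_simp
  have h : (limitHomeo Γ γ)⁻¹ ∈ preservingGroup Γ p ε δ ν := map_offDiagMeasure_symm hconf hm hJ
  exact inv_mem_iff.1 h

end Group

end CoarseLattice

/-! ### The theorem -/

open CoarseLattice in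
theorem mainTheorem6 {X : Type*} [MetricSpace X] [CoarseLattice.GromovHyperbolic X]
    (ε : ℝ) (hε : 0 < ε) (hX : CoarseLattice.IsGood X ε) (p : X)
    (Γ : Subgroup (X ≃ᵢ X)) (hΓ : CoarseLattice.MetricallyProper Γ)
    (hcompact : IsCompact (CoarseLattice.limitSet Γ))
    (δ : ℝ) (hδ : 0 < δ) (hcrit : CoarseLattice.criticalExponent Γ p = ENNReal.ofReal δ)
    (hdiv : CoarseLattice.poincareSeries Γ p δ = ⊤)
    (ν : MeasureTheory.Measure (CoarseLattice.limitSet Γ))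
    (hν : CoarseLattice.IsPattersonSullivan Γ p δ ν)
    (hlat : CoarseLattice.IsTwoAndAHalfLattice Γ p ε δ ν) :
    (CoarseLattice.restrictHom Γ).range ≤ CoarseLattice.preservingGroup Γ p ε δ ν ∧
      CoarseLattice.IsLattice
        ((CoarseLattice.restrictHom Γ).range.subgroupOf
          (CoarseLattice.preservingGroup Γ p ε δ ν)) := by
  -- This metric induces the given topology by construction, so compactness and the Borel structure
  -- carry over, and the pair measure is the off-diagonal measure by definition.
  let _ : MetricSpace (GromovBoundary X) := boundaryMetric hε hX p
  have : Nonempty X := ⟨p⟩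
  have hcount : Countable Γ := hΓ.countable
  have hcpt : CompactSpace (limitSet Γ) := isCompact_iff_compactSpace.1 hcompact
  have hprob := hν.isProbabilityMeasure
  have hpair : pairMeasure Γ p ε δ ν = offDiagMeasure ν (2 * δ / ε) := rfl
  have ha : 0 < 2 * δ / ε := by positivity
  have hconf := fun γ : Γ => isConformalFactor_limitHomeo hε hX p γ
  have hH : ∀ f, f ∈ preservingGroup Γ p ε δ ν ↔
      (offDiagMeasure ν (2 * δ / ε)).map (Prod.map f f) = offDiagMeasure ν (2 * δ / ε) :=
    fun f => Iff.rfl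
  have hle : (restrictHom Γ).range ≤ preservingGroup Γ p ε δ ν := by
    intro f hf
    obtain ⟨γ, rfl⟩ := mem_range_restrictHom.1 hf
    exact limitHomeo_mem_preservingGroup hε hX p hcpt hν γ
  refine ⟨hle, ?_⟩
  by_cases h3 : ∀ x : limitSet Γ, ∃ y z : limitSet Γ, x ≠ y ∧ x ≠ z ∧ y ≠ z
  swap
  · have := finite_of_not_three h3
    have : Finite (limitSet Γ ≃ₜ limitSet Γ) :=
      Finite.of_injective (fun f => (f : limitSet Γ → limitSet Γ)) DFunLike.coe_injective
    exact isLattice_of_finite _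
  have hnonempty : Nonempty (limitSet Γ) := nonempty_of_isProbabilityMeasure ν
  have hpos : ν.IsOpenPosMeasure := by
    refine isOpenPosMeasure_of_conformal hε hX p hν.conformal fun h0 => hlat.1.ne' ?_
    have h1 : pairMeasure Γ p ε δ ν = 0 := by
      rw [hpair, offDiagMeasure, Measure.restrict_eq_zero.2 h0, withDensity_zero_left]
    -- If ν × ν did not charge the distinct pairs, the whole space would be a null set meeting every
    -- orbit, against positivity of the quotient mass.
    have h2 : bmsMass Γ p ε δ ν ≤ bmsMeasure Γ p ε δ ν Set.univ :=
      iInf₂_le_of_le Set.univ MeasurableSet.univ (iInf_le _ fun _ _ => ⟨1, trivial⟩)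
    rw [bmsMeasure, h1, Measure.zero_prod] at h2
    simpa using h2
  have hfin := hlat.2
  simp only [bmsMass, iInf_lt_iff] at hfin
  obtain ⟨F, hF, hFL, hFfin⟩ := hfin
  have hdiam : ∀ ξ η : limitSet Γ, dist ξ η ≤ 1 := fun ξ η => visualDist_le_one hε p ξ.1 η.1
  -- The factor of γ is exp(ε β), so dividing the logarithms by 2ε reproduces the term (β_ξ - β_η)/2
  -- of the given action.
  refine isLattice_of_finite_covolume h3 hdiam ν ha hH _ (fun C => ?_)
    (mul_pos two_pos hε) hF (fun z hz => ?_) hFfin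
  · obtain ⟨a⟩ := hnonempty
    obtain ⟨b, -, hab, -⟩ := h3 a
    -- Bi-Lipschitz bounds give factors at least (C + 1)⁻³, hence this lower bound on the Busemann
    -- functions; C + 1 replaces C to keep the logarithm's argument positive.
    obtain ⟨R, hR⟩ := exists_dist_le_of_le_busemann hε hX p (fun h => hab (Subtype.ext h))
      (Real.log ((((C + 1 : NNReal) : ℝ) ^ 3)⁻¹) / ε)
    refine ((hΓ p R).image fun γ : Γ => (⟨limitHomeo Γ γ,
      hle (mem_range_restrictHom.2 ⟨γ, rfl⟩)⟩ : preservingGroup Γ p ε δ ν)).subset ?_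
    rintro ⟨h, hh⟩ ⟨⟨h1, h2⟩, hL⟩
    obtain ⟨γ, rfl⟩ := mem_range_restrictHom.1 (Subgroup.mem_subgroupOf.1 hL)
    have hb : ∀ ξ : limitSet Γ, Real.log ((((C + 1 : NNReal) : ℝ) ^ 3)⁻¹) / ε ≤
        busemann ξ.1 p (γ.1⁻¹ p) := by
      intro ξ
      have hC : (C : NNReal) ≤ C + 1 := le_self_add
      have h4 := (hconf γ).le_of_lipschitzWith h3 (h1.weaken hC) (h2.weaken hC) ξ
      have h5 := Real.log_le_log (by positivity) h4
      rw [Real.log_exp] at h5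
      rwa [div_le_iff₀' hε]
    refine ⟨γ, ?_, rfl⟩
    have h6 := hR _ (hb a) (hb b)
    rw [← γ.1.dist_eq p] at h6
    have h7 : γ.1 (γ.1⁻¹ p) = p := γ.1.apply_symm_apply p
    rw [h7, dist_comm] at h6
    exact h6
  · obtain ⟨γ, hγ⟩ := hFL z hz
    refine ⟨⟨limitHomeo Γ γ, hle (mem_range_restrictHom.2 ⟨γ, rfl⟩)⟩,
      Subgroup.mem_subgroupOf.2 (mem_range_restrictHom.2 ⟨γ, rfl⟩), ?_⟩
    convert hγ using 1
    refine Prod.ext rfl ?_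
    simp only [flowLift, flowAct, (hconf γ).conformalFactor_eq h3, Real.log_exp]
    field_simp
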